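/- For every $\eta\in(0,1/3)$ there is a constant $C_\eta$ such that the following holds for every finite simple graph $G$ with maximum degree $\Delta\ge C_\eta$. There is a set $S\subseteq V(G)$ such that every vertex $v\in V(G)$ satisfies $$|N(v)\cap S^c|\le(1-\eta)\Delta\qquad\text{and}\qquad |N(v)\cap S|\le \Delta/3, \qquad (*)$$ where $N(v)$ is the neighborhood of $v$ and $S^c=V(G)\setminus S$. Furthermore, there is a randomized algorithm, depending only on $\eta$, which, given any graph $G$ on $n$ vertices with maximum degree $\Delta\ge C_\eta$, always halts in time at most $K_\eta\,(n\Delta+n\log n)$, where $K_\eta$ depends only on $\eta$, and which outputs with probability at least $1/2$ a set $S$ that satisfies $(*)$ for all $v\in V(G)$. Here an algorithm is a program for a word RAM with words of $w$ bits, for any $w\ge b_\eta(\lfloor\log_2 n\rfloor+1)$ with $b_\eta$ depending only on $\eta$; $G$ is given by $n$ and adjacency lists, in an arbitrary order; and memory accesses, arithmetic operations and comparisons of words, and tosses of a fair coin each take unit time. -/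

import Mathlib

/-- `S` is a seeding set of `G` (with parameters `η` and `Δ`): every vertex has at most `(1 - η) Δ`
neighbours outside `S` and at most `Δ / 3` neighbours inside `S`. -/
def IsSeedingSet {V : Type*} (G : SimpleGraph V) (η : ℝ) (Δ : ℕ) (S : Set V) : Prop :=
  ∀ v : V, ((G.neighborSet v ∩ Sᶜ).ncard : ℝ) ≤ (1 - η) * Δ ∧
    ((G.neighborSet v ∩ S).ncard : ℝ) ≤ (Δ : ℝ) / 3

/-!
The model of computation is the randomized word RAM with words of `w` bits, programmed in a
structured language. A program is a finite syntactic object, which mentions finitely many registers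
and finitely many arrays. A register, and each cell of an array, holds one word. The unit-time
operations are: a register access, an array access, one arithmetic operation or comparison of words,
a test in a branch or a loop, and one toss of a fair coin.
-/
namespace WordRAM

/-- The word operations. -/
inductive BinOp where
  | add | sub | mul | div | lt | eq

/-- The result of a word operation on `w`-bit words, reduced modulo `2 ^ w`. Subtraction is
truncated at `0`, division rounds down, comparisons return `1` (true) or `0` (false). -/
def BinOp.eval (w : ℕ) : BinOp → ℕ → ℕ → ℕ
  | .add, a, b => (a + b) % 2 ^ w
  | .sub, a, b => (a - b) % 2 ^ w
  | .mul, a, b => (a * b) % 2 ^ w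
  | .div, a, b => (a / b) % 2 ^ w
  | .lt, a, b => (if a < b then 1 else 0) % 2 ^ w
  | .eq, a, b => (if a = b then 1 else 0) % 2 ^ w

/-- Expressions: constants, registers, array cells `a[e]`, and word operations. -/
inductive Expr where
  | const (c : ℕ)
  | reg (x : ℕ)
  | cell (a : ℕ) (i : Expr)
  | op (o : BinOp) (e₁ e₂ : Expr)

/-- Programs. -/
inductive Prog where
  /-- do nothing -/
  | skip
  /-- set register `x` to the value of `e` -/
  | assign (x : ℕ) (e : Expr)
  /-- set cell `i` of array `a` to the value of `e` -/
  | store (a : ℕ) (i e : Expr)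
  /-- toss a fair coin and put the result, `0` or `1`, into register `x` -/
  | toss (x : ℕ)
  /-- run `p`, then `q` -/
  | seq (p q : Prog)
  /-- if the value of `e` is nonzero run `p`, otherwise run `q` -/
  | cond (e : Expr) (p q : Prog)
  /-- while the value of `e` is nonzero run `p` -/
  | loop (e : Expr) (p : Prog)

/-- The state of the machine: the registers, the arrays, and the number of coins tossed so far. -/
@[ext] structure State where
  reg : ℕ → ℕ
  arr : ℕ → ℕ → ℕ
  tossed : ℕ

/-- The value of an expression. -/
def Expr.eval (w : ℕ) (σ : State) : Expr → ℕ
  | .const c => c % 2 ^ w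
  | .reg x => σ.reg x
  | .cell a i => σ.arr a (i.eval w σ)
  | .op o e₁ e₂ => o.eval w (e₁.eval w σ) (e₂.eval w σ)

/-- The time it takes to evaluate an expression: one unit for each constant, register access, array
access and word operation that occurs in it. -/
def Expr.cost : Expr → ℕ
  | .const _ => 1
  | .reg _ => 1
  | .cell _ i => i.cost + 1
  | .op _ e₁ e₂ => e₁.cost + e₂.cost + 1

/-- `Exec w ω p σ t σ'`: on the machine with `w`-bit words whose successive coin tosses come out as
`ω 0, ω 1, ω 2, …`, the program `p` started in state `σ` halts after time `t` in state `σ'`. -/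
inductive Exec (w : ℕ) (ω : ℕ → Bool) : Prog → State → ℕ → State → Prop
  | skip (σ : State) : Exec w ω .skip σ 1 σ
  | assign (σ : State) (x : ℕ) (e : Expr) :
      Exec w ω (.assign x e) σ (e.cost + 1)
        { σ with reg := Function.update σ.reg x (e.eval w σ) }
  | store (σ : State) (a : ℕ) (i e : Expr) :
      Exec w ω (.store a i e) σ (i.cost + e.cost + 1)
        { σ with arr :=
            Function.update σ.arr a (Function.update (σ.arr a) (i.eval w σ) (e.eval w σ)) }
  | toss (σ : State) (x : ℕ) :
      Exec w ω (.toss x) σ 1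
        { σ with
          reg := Function.update σ.reg x (if ω σ.tossed then 1 else 0)
          tossed := σ.tossed + 1 }
  | seq {σ σ₁ σ₂ : State} {s t : ℕ} {p q : Prog}
      (hp : Exec w ω p σ s σ₁) (hq : Exec w ω q σ₁ t σ₂) : Exec w ω (.seq p q) σ (s + t) σ₂
  | cond_true {σ σ₁ : State} {t : ℕ} {e : Expr} {p : Prog} (q : Prog)
      (he : e.eval w σ ≠ 0) (hp : Exec w ω p σ t σ₁) :
      Exec w ω (.cond e p q) σ (e.cost + 1 + t) σ₁
  | cond_false {σ σ₁ : State} {t : ℕ} {e : Expr} (p : Prog) {q : Prog}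
      (he : e.eval w σ = 0) (hq : Exec w ω q σ t σ₁) :
      Exec w ω (.cond e p q) σ (e.cost + 1 + t) σ₁
  | loop_true {σ σ₁ σ₂ : State} {s t : ℕ} {e : Expr} {p : Prog}
      (he : e.eval w σ ≠ 0) (hp : Exec w ω p σ s σ₁) (hl : Exec w ω (.loop e p) σ₁ t σ₂) :
      Exec w ω (.loop e p) σ (e.cost + 1 + s + t) σ₂
  | loop_false {σ : State} {e : Expr} (p : Prog) (he : e.eval w σ = 0) :
      Exec w ω (.loop e p) σ (e.cost + 1) σ

/-- Once the coin tosses are given, running time and final state of a program are determined. -/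
theorem Exec.unique {w : ℕ} {ω : ℕ → Bool} {p : Prog} {σ : State} {s t : ℕ} {σ₁ σ₂ : State}
    (h₁ : Exec w ω p σ s σ₁) (h₂ : Exec w ω p σ t σ₂) : s = t ∧ σ₁ = σ₂ := by
  induction h₁ generalizing t σ₂ with
  | skip | assign | store | toss => cases h₂; exact ⟨rfl, rfl⟩
  | seq _ _ ihp ihq =>
    cases h₂ with
    | seq hp hq =>
      obtain ⟨rfl, rfl⟩ := ihp hp
      obtain ⟨rfl, rfl⟩ := ihq hq
      exact ⟨rfl, rfl⟩
  | cond_true _ he _ ih =>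
    cases h₂ with
    | cond_true _ _ hp => obtain ⟨rfl, rfl⟩ := ih hp; exact ⟨rfl, rfl⟩
    | cond_false _ he' _ => exact absurd he' he
  | cond_false _ he _ ih =>
    cases h₂ with
    | cond_true _ he' _ => exact absurd he he'
    | cond_false _ _ hp => obtain ⟨rfl, rfl⟩ := ih hp; exact ⟨rfl, rfl⟩
  | loop_true he _ _ ihp ihl =>
    cases h₂ with
    | loop_true _ hp hl =>
      obtain ⟨rfl, rfl⟩ := ihp hp
      obtain ⟨rfl, rfl⟩ := ihl hl
      exact ⟨rfl, rfl⟩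
    | loop_false _ he' => exact absurd he' he
  | loop_false _ he =>
    cases h₂ with
    | loop_true he' _ _ => exact absurd he he'
    | loop_false => exact ⟨rfl, rfl⟩

/-- The law of an infinite sequence of independent fair coin tosses. -/
noncomputable def coinLaw : MeasureTheory.Measure (ℕ → Bool) :=
  MeasureTheory.Measure.infinitePi fun _ : ℕ => (PMF.uniformOfFintype Bool).toMeasure

/-- `σ` is an initial state that holds the graph `G` on the vertices `0, …, n - 1` by adjacency
lists: register `0` holds `n`, the list of the neighbours of `v`, in some order and without
repetition, stands in the cells `arr 0 v, …, arr 0 (v + 1) - 1` of array `1`, and these lists follow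
each other in the order of the vertices. Everything else is `0`, and no coin has been tossed. -/
structure HoldsGraph {n : ℕ} (G : SimpleGraph (Fin n)) [DecidableRel G.Adj] (σ : State) :
    Prop where
  size : σ.reg 0 = n
  start_zero : σ.arr 0 0 = 0
  start_succ : ∀ v : Fin n, σ.arr 0 (v + 1) = σ.arr 0 v + G.degree v
  adjacency : ∀ v : Fin n,
    Set.BijOn (σ.arr 1) (Set.Ico (σ.arr 0 v) (σ.arr 0 (v + 1)))
      ((fun u : Fin n => (u : ℕ)) '' G.neighborSet v)
  reg_eq_zero : ∀ x, x ≠ 0 → σ.reg x = 0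
  start_eq_zero : ∀ i, n < i → σ.arr 0 i = 0
  adjacency_eq_zero : ∀ j, σ.arr 0 n ≤ j → σ.arr 1 j = 0
  arr_eq_zero : ∀ a, 2 ≤ a → ∀ i, σ.arr a i = 0
  tossed_eq_zero : σ.tossed = 0

/-- The set of vertices that a halted machine has computed; its indicator stands in array `2`. -/
def output (n : ℕ) (σ : State) : Set (Fin n) := {v | σ.arr 2 v = 1}

end WordRAM

/-! Select each vertex independently with probability p = (a + 1) / 2 ^ k, where η ≤ a / 2 ^ k and p
+ 2 ^ (-k) ≤ 1/3. Both requirements at a vertex then have slack Δ / 2 ^ k, so Hoeffding's inequality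
bounds the probability that it is violated by q = 2 exp(-2Δ / 4 ^ k), which is far below Δ ^ (-2)
for large Δ (`violationBound_viol`, `exists_degree_bound`).

The algorithm is a local resampling in the style of Moser and Tardos, driven by a queue that at
first holds every vertex. At time t the t-th entry v is checked; if v is violated, all its
neighbours receive fresh samples, and the at most Δ² neighbours of these neighbours are appended.
Every violated vertex is always still waiting in the queue (`mem_drop_of_violated`), so an exhausted
queue certifies a seeding set.

It remains to see that the queue rarely exceeds 2n entries. If the set B of resampling times is
prescribed, then the vertices checked and the samples they read no longer depend on the randomness.
A resampling discards every sample that its check has read, so the checks at the times in B read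
disjoint sets of samples and all find violations with probability at most q ^ |B|
(`consistent_bound`). An overlong queue needs |B| Δ² > n, and a union bound over all such B within
the first 2n times gives failure probability at most 1/2 (`half_le_measure_succeeds`).

A success with positive probability already yields the set S. For the algorithm, a word RAM program
is shown to simulate this run, cut off once the queue exceeds 2n, with sample m made from the coins
k m, …, k m + k - 1. There are at most 2n checks of cost O(Δ) each, for fixed k, hence time O(nΔ).
-/

namespace LocalResampling

/-! ### Resampling runs, prescribed schedules and the queue -/

/-- The data of a run that do not depend on the values of the samples: which sample each vertex
holds, how many samples have been drawn, and the queue of vertices to be checked. -/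
structure Config where
  slot : ℕ → ℕ
  used : ℕ
  queue : List ℕ

/-- Draw fresh samples for the neighbours of `v`, and queue the neighbours of these neighbours. -/
def Config.resample (nbr : ℕ → List ℕ) (v : ℕ) (s : Config) : Config where
  slot u := if u ∈ nbr v then s.used + (nbr v).idxOf u else s.slot u
  used := s.used + (nbr v).length
  queue := s.queue ++ (nbr v).flatMap nbr

/-- The vertex that is checked at time `t`. -/
def Config.vertex (s : Config) (t : ℕ) : ℕ := s.queue.getD t 0

/-- The initial configuration: vertex `v` holds sample `v`, and all vertices are queued. -/
def Config.start (n : ℕ) : Config := ⟨id, n, List.range n⟩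

/-- Whether `v` is violated when the samples are `x`; `viol c d` tells whether a vertex of degree
`d` with `c` selected neighbours is. -/
def violated (nbr : ℕ → List ℕ) (viol : ℕ → ℕ → Bool) (x : ℕ → Bool) (slot : ℕ → ℕ) (v : ℕ) :
    Bool :=
  viol ((nbr v).countP fun u => x (slot u)) (nbr v).length

/-- The configuration at time `t` if resampling takes place exactly at the times in `B`. -/
def sched (nbr : ℕ → List ℕ) (n : ℕ) (B : Finset ℕ) : ℕ → Config
  | 0 => .start n
  | t + 1 =>
    let s := sched nbr n B t
    if t ∈ B then s.resample nbr (s.vertex t) else s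

/-- The configuration at time `t` of the run on the samples `x`. -/
def run (nbr : ℕ → List ℕ) (n : ℕ) (viol : ℕ → ℕ → Bool) (x : ℕ → Bool) : ℕ → Config
  | 0 => .start n
  | t + 1 =>
    let s := run nbr n viol x t
    if violated nbr viol x s.slot (s.vertex t) then s.resample nbr (s.vertex t) else s

/-- The times before `t` at which the run on the samples `x` resamples. -/
def resampleTimes (nbr : ℕ → List ℕ) (n : ℕ) (viol : ℕ → ℕ → Bool) (x : ℕ → Bool) (t : ℕ) :
    Finset ℕ :=
  (Finset.range t).filter fun r =>
    violated nbr viol x (run nbr n viol x r).slot ((run nbr n viol x r).vertex r)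

/-- `nbr` lists the neighbours in a graph on `0, …, n - 1` with degrees at most `Δ`. -/
structure IsNbr (n Δ : ℕ) (nbr : ℕ → List ℕ) : Prop where
  nodup : ∀ v < n, (nbr v).Nodup
  length_le : ∀ v < n, (nbr v).length ≤ Δ
  lt : ∀ v < n, ∀ u ∈ nbr v, u < n
  symm : ∀ v < n, ∀ u ∈ nbr v, v ∈ nbr u

/-- The configurations that can occur. -/
structure Config.Valid (n : ℕ) (s : Config) : Prop where
  queue_lt : ∀ u ∈ s.queue, u < n
  slot_lt : ∀ u < n, s.slot u < s.used
  slot_inj : ∀ u < n, ∀ v < n, s.slot u = s.slot v → u = v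

variable {n Δ : ℕ} {nbr : ℕ → List ℕ} {viol : ℕ → ℕ → Bool}

theorem Config.valid_start (n : ℕ) : (Config.start n).Valid n :=
  ⟨by simp [Config.start], by simp [Config.start], by simp [Config.start]⟩

/-- Past the end of the queue the default vertex 0 is checked, which is a vertex because n > 0. In a
genuine run this changes nothing, since no vertex is violated by then. -/
theorem Config.Valid.vertex_lt {s : Config} (hs : s.Valid n) (hn : 0 < n) (t : ℕ) :
    s.vertex t < n := by
  unfold Config.vertex
  by_cases h : t < s.queue.length
  · rw [List.getD_eq_getElem _ _ h]
    exact hs.queue_lt _ (List.getElem_mem h)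
  · rw [List.getD_eq_default _ _ (by omega)]
    exact hn

theorem Config.Valid.resample {s : Config} (hs : s.Valid n) (hnbr : IsNbr n Δ nbr) {v : ℕ}
    (hv : v < n) : (s.resample nbr v).Valid n where
  queue_lt u hu := by
    simp only [Config.resample, List.mem_append, List.mem_flatMap] at hu
    rcases hu with hu | ⟨a, ha, hu⟩
    · exact hs.queue_lt u hu
    · exact hnbr.lt a (hnbr.lt v hv a ha) u hu
  slot_lt u hu := by
    simp only [Config.resample]
    split_ifs with h
    · have := List.idxOf_lt_length_of_mem h
      omega
    · have := hs.slot_lt u hu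
      omega
  slot_inj u hu w hw h := by
    simp only [Config.resample] at h
    have h1 := hs.slot_lt u hu
    have h2 := hs.slot_lt w hw
    split_ifs at h with ha hb hb
    · exact (List.idxOf_inj ha).1 (by omega)
    · omega
    · omega
    · exact hs.slot_inj u hu w hw h

theorem valid_sched (hnbr : IsNbr n Δ nbr) (hn : 0 < n) (B : Finset ℕ) (t : ℕ) :
    (sched nbr n B t).Valid n := by
  induction t with
  | zero => exact Config.valid_start n
  | succ t ih =>
    simp only [sched]
    split_ifs
    · exact ih.resample hnbr (ih.vertex_lt hn t)
    · exact ih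

theorem valid_run (hnbr : IsNbr n Δ nbr) (hn : 0 < n) (x : ℕ → Bool) (t : ℕ) :
    (run nbr n viol x t).Valid n := by
  induction t with
  | zero => exact Config.valid_start n
  | succ t ih =>
    simp only [run]
    split_ifs
    · exact ih.resample hnbr (ih.vertex_lt hn t)
    · exact ih

/-- This replaces a run, whose course depends on the samples, by a deterministic schedule, at the
price of a union over all possible sets of resampling times. -/
theorem sched_resampleTimes (x : ℕ → Bool) {t r : ℕ} (hr : r ≤ t) :
    sched nbr n (resampleTimes nbr n viol x t) r = run nbr n viol x r := by
  induction r with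
  | zero => rfl
  | succ r ih =>
    have ih := ih (by omega)
    have hr' : r < t := hr
    have hmem : r ∈ resampleTimes nbr n viol x t ↔
        violated nbr viol x (run nbr n viol x r).slot ((run nbr n viol x r).vertex r) := by
      simp [resampleTimes, hr']
    simp only [sched, run, ih, hmem]

theorem length_flatMap_le (hnbr : IsNbr n Δ nbr) {v : ℕ} (hv : v < n) :
    ((nbr v).flatMap nbr).length ≤ Δ * Δ := by
  rw [List.length_flatMap]
  have := List.sum_le_card_nsmul ((nbr v).map fun u => (nbr u).length) Δ (by
    intro a ha
    obtain ⟨u, hu, rfl⟩ := List.mem_map.1 ha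
    exact hnbr.length_le u (hnbr.lt v hv u hu))
  rw [List.length_map, smul_eq_mul] at this
  exact this.trans (Nat.mul_le_mul_right _ (hnbr.length_le v hv))

theorem resampleTimes_succ (x : ℕ → Bool) (t : ℕ) :
    resampleTimes nbr n viol x (t + 1) =
      if violated nbr viol x (run nbr n viol x t).slot ((run nbr n viol x t).vertex t) then
        insert t (resampleTimes nbr n viol x t) else resampleTimes nbr n viol x t := by
  simp only [resampleTimes, Finset.range_add_one, Finset.filter_insert]

theorem length_queue_le (hnbr : IsNbr n Δ nbr) (hn : 0 < n) (x : ℕ → Bool) (t : ℕ) :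
    (run nbr n viol x t).queue.length ≤ n + (resampleTimes nbr n viol x t).card * (Δ * Δ) := by
  induction t with
  | zero => simp [run, Config.start]
  | succ t ih =>
    rw [resampleTimes_succ]
    simp only [run]
    split_ifs with h
    · rw [Finset.card_insert_of_notMem (by simp [resampleTimes])]
      have := length_flatMap_le hnbr ((valid_run (viol := viol) hnbr hn x t).vertex_lt hn t)
      simp only [Config.resample, List.length_append]
      linarith
    · exact ih

/-- Correctness invariant: entries from position t on are still to be checked. A vertex can become
violated only when the sample of one of its neighbours changes, and exactly then it is appended
again. -/
theorem mem_drop_of_violated (h0 : viol 0 0 = false) (hnbr : IsNbr n Δ nbr) (hn : 0 < n) (x : ℕ → Bool) (t : ℕ) {u : ℕ}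
    (hu : u < n) (h : violated nbr viol x (run nbr n viol x t).slot u) :
    u ∈ (run nbr n viol x t).queue.drop t := by
  induction t generalizing u with
  | zero => simpa [run, Config.start] using hu
  | succ t ih =>
    have key : ∀ a < n, violated nbr viol x (run nbr n viol x t).slot a →
        a = (run nbr n viol x t).vertex t ∨ a ∈ (run nbr n viol x t).queue.drop (t + 1) := by
      intro a ha hva
      have := ih ha hva
      have hlt : t < (run nbr n viol x t).queue.length := by
        by_contra hcon
        rw [List.drop_eq_nil_of_le (by omega)] at this
        simp at this
      rw [List.drop_eq_getElem_cons hlt, List.mem_cons] at this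
      simpa only [Config.vertex, List.getD_eq_getElem _ _ hlt] using this
    simp only [run] at h ⊢
    split_ifs at h ⊢ with hv
    · set s := run nbr n viol x t with hs
      set v := s.vertex t with hvdef
      have hvn : v < n := (valid_run (viol := viol) hnbr hn x t).vertex_lt hn t
      simp only [Config.resample]
      have hlt : t < s.queue.length := by
        have := ih hvn hv
        by_contra hcon
        rw [List.drop_eq_nil_of_le (by omega)] at this
        simp at this
      rw [List.drop_append_of_le_length (by omega), List.mem_append]
      -- Either u has a neighbour in common with v and has just been appended, or none of the
      -- samples that u reads has changed and u was violated before.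
      by_cases hc : ∃ a ∈ nbr u, a ∈ nbr v
      · obtain ⟨a, hau, hav⟩ := hc
        exact Or.inr (List.mem_flatMap.2 ⟨a, hav, hnbr.symm u hu a hau⟩)
      · left
        have : violated nbr viol x s.slot u := by
          rw [← h]
          unfold violated
          congr 1
          apply List.countP_congr
          intro a ha
          have : a ∉ nbr v := fun hav => hc ⟨a, ha, hav⟩
          simp [Config.resample, this]
        rcases key u hu this with rfl | h2
        -- The checked vertex v leaves the queue, but any neighbour of v puts it back. So v could be
        -- lost only if isolated, and then `h0` says that it is not violated.
        · have hnil : nbr v = [] := by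
            by_contra hne
            obtain ⟨a, ha⟩ := List.exists_mem_of_ne_nil _ hne
            exact hc ⟨a, ha, ha⟩
          have hfalse : violated nbr viol x s.slot v = false := by
            rw [violated, hnil]
            exact h0
          rw [hfalse] at hv
          cases hv
        · exact h2
    · rcases key u hu h with rfl | h2
      · exact absurd h hv
      · exact h2

end LocalResampling

/-! ### Failure probability by a union bound over schedules -/

open MeasureTheory ProbabilityTheory

namespace LocalResampling

variable {n Δ : ℕ} {nbr : ℕ → List ℕ} {viol : ℕ → ℕ → Bool}
variable {Ω : Type*}

/-- An event that is determined by the samples with indices in `D`. -/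
def DeterminedBy (X : ℕ → Ω → Bool) (D : Finset ℕ) (E : Set Ω) : Prop :=
  ∃ A : Set (D → Bool), E = {ω | (fun i : D => X i ω) ∈ A}

theorem DeterminedBy.mono {X : ℕ → Ω → Bool} {D D' : Finset ℕ} {E : Set Ω}
    (h : DeterminedBy X D E) (hD : D ⊆ D') : DeterminedBy X D' E := by
  obtain ⟨A, rfl⟩ := h
  exact ⟨{f | (fun i : D => f ⟨i, hD i.2⟩) ∈ A}, rfl⟩

theorem DeterminedBy.inter {X : ℕ → Ω → Bool} {D : Finset ℕ} {E E' : Set Ω}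
    (h : DeterminedBy X D E) (h' : DeterminedBy X D E') : DeterminedBy X D (E ∩ E') := by
  obtain ⟨A, rfl⟩ := h
  obtain ⟨A', rfl⟩ := h'
  exact ⟨A ∩ A', rfl⟩

variable [MeasurableSpace Ω] {P : Measure Ω}

theorem DeterminedBy.measure_inter {X : ℕ → Ω → Bool} (hX : iIndepFun X P)
    (hm : ∀ i, Measurable (X i)) {D D' : Finset ℕ} (hD : Disjoint D D') {E E' : Set Ω}
    (h : DeterminedBy X D E) (h' : DeterminedBy X D' E') :
    P.real (E ∩ E') = P.real E * P.real E' := by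
  obtain ⟨A, rfl⟩ := h
  obtain ⟨A', rfl⟩ := h'
  have := (hX.indepFun_finset D D' hD hm).measure_inter_preimage_eq_mul A A'
    A.toFinite.measurableSet A'.toFinite.measurableSet
  simp only [Measure.real, ← ENNReal.toReal_mul]
  exact congrArg ENNReal.toReal this

/-- The event that the schedule `B` asks only for resampling at violated vertices before time `t`. -/
def consistent (nbr : ℕ → List ℕ) (n : ℕ) (viol : ℕ → ℕ → Bool) (X : ℕ → Ω → Bool) (B : Finset ℕ)
    (t : ℕ) : Set Ω :=
  {ω | ∀ r < t, r ∈ B → violated nbr viol (X · ω) (sched nbr n B r).slot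
    ((sched nbr n B r).vertex r)}

/-- `q` bounds the probability that fresh samples violate a vertex of degree at most `Δ`. -/
def ViolationBound (P : Measure Ω) (viol : ℕ → ℕ → Bool) (X : ℕ → Ω → Bool) (Δ : ℕ) (q : ℝ) :
    Prop :=
  ∀ I : Finset ℕ, I.card ≤ Δ → P.real {ω | viol (I.filter fun i => X i ω).card I.card} ≤ q

/-- Distinct vertices hold distinct samples, so the check counts successes in a set of sample
indices, the form to which `ViolationBound` and independence apply. -/
theorem violated_eq {s : Config} (hs : s.Valid n) (hnbr : IsNbr n Δ nbr) {v : ℕ} (hv : v < n)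
    (x : ℕ → Bool) :
    violated nbr viol x s.slot v =
      viol (((nbr v).toFinset.image s.slot).filter fun i => x i).card
        ((nbr v).toFinset.image s.slot).card := by
  have hinj : Set.InjOn s.slot (nbr v).toFinset := by
    intro a ha b hb hab
    simp only [List.coe_toFinset, Set.mem_ofPred_eq] at ha hb
    exact hs.slot_inj a (hnbr.lt v hv a ha) b (hnbr.lt v hv b hb) hab
  rw [violated, Finset.filter_image, Finset.card_image_of_injOn hinj,
    Finset.card_image_of_injOn (hinj.mono fun a ha => Finset.filter_subset _ _ ha),
    List.toFinset_card_of_nodup (hnbr.nodup v hv), List.countP_eq_length_filter,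
    ← List.toFinset_filter, List.toFinset_card_of_nodup ((hnbr.nodup v hv).filter _)]

/-- Induction on time. The event is determined by a set D of retired samples: already drawn, and no
longer held by any vertex. The next check reads only held samples, so it is independent of the past
and contributes a factor q; after the resampling the samples that it read are retired too. -/
theorem consistent_bound [IsProbabilityMeasure P] (hnbr : IsNbr n Δ nbr) (hn : 0 < n) {X : ℕ → Ω → Bool}
    (hX : iIndepFun X P) (hm : ∀ i, Measurable (X i)) {q : ℝ} (hq : 0 ≤ q)
    (hb : ViolationBound P viol X Δ q) (B : Finset ℕ) (t : ℕ) :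
    ∃ D : Finset ℕ, DeterminedBy X D (consistent nbr n viol X B t) ∧
      (∀ i ∈ D, i < (sched nbr n B t).used ∧ ∀ u < n, (sched nbr n B t).slot u ≠ i) ∧
      P.real (consistent nbr n viol X B t) ≤ q ^ (B.filter (· < t)).card := by
  induction t with
  | zero => exact ⟨∅, ⟨Set.univ, by simp [consistent]⟩, by simp, by simp⟩
  | succ t ih =>
    obtain ⟨D, hD, hDs, hP⟩ := ih
    have hsv := valid_sched hnbr hn B t
    set s := sched nbr n B t with hs
    by_cases ht : t ∈ B
    · set v := s.vertex t with hv
      have hvn : v < n := hsv.vertex_lt hn t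
      set I := (nbr v).toFinset.image s.slot with hI
      have hDI : Disjoint D I := by
        rw [Finset.disjoint_left]
        intro i hi hi'
        obtain ⟨u, hu, rfl⟩ := Finset.mem_image.1 hi'
        exact (hDs _ hi).2 u (hnbr.lt v hvn u (List.mem_toFinset.1 hu)) rfl
      have hE : DeterminedBy X I {ω | violated nbr viol (X · ω) s.slot v} := by
        refine ⟨{f | viol (Finset.univ.filter fun i => f i).card I.card}, ?_⟩
        ext ω
        simp only [Set.mem_ofPred_eq, violated_eq hsv hnbr hvn, ← hI]
        rw [← Finset.card_map (Function.Embedding.subtype _)]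
        have : (Finset.univ.filter fun i : I => X i ω).map (Function.Embedding.subtype _) =
            I.filter fun i => X i ω := by
          ext i
          simp [and_comm]
        rw [this]
      have hsucc : consistent nbr n viol X B (t + 1) =
          consistent nbr n viol X B t ∩ {ω | violated nbr viol (X · ω) s.slot v} := by
        ext ω
        simp only [consistent, Set.mem_ofPred_eq, Set.mem_inter_iff, Order.lt_add_one_iff]
        constructor
        · exact fun h => ⟨fun r hr => h r hr.le, h t le_rfl ht⟩
        · rintro ⟨h, h'⟩ r hr hrB
          rcases hr.lt_or_eq with hr | rfl
          · exact h r hr hrB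
          · exact h'
      have hnext : sched nbr n B (t + 1) = s.resample nbr v := by
        simp [sched, ht, ← hs, ← hv]
      refine ⟨D ∪ I, ?_, ?_, ?_⟩
      · rw [hsucc]
        exact (hD.mono Finset.subset_union_left).inter (hE.mono Finset.subset_union_right)
      · intro i hi
        rw [hnext]
        have hlt : i < s.used := by
          rcases Finset.mem_union.1 hi with hi | hi
          · exact (hDs i hi).1
          · obtain ⟨u, hu, rfl⟩ := Finset.mem_image.1 hi
            exact hsv.slot_lt u (hnbr.lt v hvn u (List.mem_toFinset.1 hu))
        refine ⟨by simp only [Config.resample]; omega, fun u hu => ?_⟩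
        simp only [Config.resample]
        split_ifs with hun
        · omega
        · rcases Finset.mem_union.1 hi with hi | hi
          · exact (hDs i hi).2 u hu
          -- A vertex outside N(v) cannot hold a sample that the check has read, since by
          -- injectivity of `slot` it would be in N(v).
          · obtain ⟨a, ha, rfl⟩ := Finset.mem_image.1 hi
            have ha := List.mem_toFinset.1 ha
            intro hua
            exact hun (hsv.slot_inj u hu a (hnbr.lt v hvn a ha) hua ▸ ha)
      · have hcard : (B.filter (· < t + 1)).card = (B.filter (· < t)).card + 1 := by
          have : B.filter (· < t + 1) = insert t (B.filter (· < t)) := by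
            ext r
            simp only [Finset.mem_filter, Finset.mem_insert]
            constructor
            · rintro ⟨h, h'⟩
              by_cases hrt : r = t
              · exact Or.inl hrt
              · exact Or.inr ⟨h, by omega⟩
            · rintro (rfl | ⟨h, h'⟩)
              · exact ⟨ht, by omega⟩
              · exact ⟨h, by omega⟩
          rw [this, Finset.card_insert_of_notMem (by simp)]
        rw [hsucc, hD.measure_inter hX hm hDI hE, hcard, pow_succ]
        refine mul_le_mul hP ?_ measureReal_nonneg (by positivity)
        simp only [violated_eq hsv hnbr hvn]
        refine hb I (Finset.card_image_le.trans ?_)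
        rw [List.toFinset_card_of_nodup (hnbr.nodup v hvn)]
        exact hnbr.length_le v hvn
    · have hsucc : consistent nbr n viol X B (t + 1) = consistent nbr n viol X B t := by
        ext ω
        simp only [consistent, Set.mem_ofPred_eq]
        refine ⟨fun h r hr => h r (by omega), fun h r hr hrB => h r ?_ hrB⟩
        rcases (Nat.lt_succ_iff.1 hr).lt_or_eq with hr | rfl
        · exact hr
        · exact absurd hrB ht
      have hnext : sched nbr n B (t + 1) = s := by simp [sched, ht, ← hs]
      refine ⟨D, hsucc ▸ hD, hnext ▸ hDs, ?_⟩
      rw [hsucc]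
      have : B.filter (· < t + 1) = B.filter (· < t) := by
        ext r
        simp only [Finset.mem_filter, and_congr_right_iff]
        intro hr
        have : r ≠ t := fun h => ht (h ▸ hr)
        omega
      rwa [this]

/-- The queue stays short. -/
def Succeeds (nbr : ℕ → List ℕ) (n : ℕ) (viol : ℕ → ℕ → Bool) (x : ℕ → Bool) : Prop :=
  ∀ t ≤ 2 * n, (run nbr n viol x t).queue.length ≤ 2 * n

variable [IsProbabilityMeasure P]

/-- Each resampling lengthens the queue by at most Δ², so failure requires more than n / Δ² of them
within 2n steps. The sum of q ^ |B| over such sets B is estimated by an exponential tilt. -/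
theorem half_le_measure_succeeds (hnbr : IsNbr n Δ nbr) (hn : 0 < n) (hΔ : 0 < Δ) {X : ℕ → Ω → Bool}
    (hX : iIndepFun X P) (hm : ∀ i, Measurable (X i)) {q : ℝ} (hq : 0 < q)
    (hqΔ : 12 * Δ ^ 2 * q ≤ 1)
    (hb : ViolationBound P viol X Δ q) :
    1 / 2 ≤ P {ω | Succeeds nbr n viol (X · ω)} := by
  set F : Finset (Finset ℕ) := (Finset.range (2 * n)).powerset.filter
    fun B => n < B.card * (Δ * Δ) with hF
  have hsub : {ω | Succeeds nbr n viol (X · ω)}ᶜ ⊆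
      ⋃ B ∈ F, consistent nbr n viol X B (2 * n) := by
    intro ω hω
    simp only [Set.mem_compl_iff, Set.mem_ofPred_eq, Succeeds, not_forall, not_le] at hω
    obtain ⟨t, ht, hlen⟩ := hω
    have hle := length_queue_le (viol := viol) hnbr hn (X · ω) t
    simp only [Set.mem_iUnion]
    refine ⟨resampleTimes nbr n viol (X · ω) t, ?_, ?_⟩
    · simp only [hF, Finset.mem_filter, Finset.mem_powerset]
      refine ⟨fun r hr => ?_, by omega⟩
      simp only [resampleTimes, Finset.mem_filter, Finset.mem_range] at hr
      exact Finset.mem_range.2 (by omega)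
    · intro r _ hr
      have hr' := hr
      simp only [resampleTimes, Finset.mem_filter, Finset.mem_range] at hr'
      rw [sched_resampleTimes _ hr'.1.le]
      exact hr'.2
  have hterm : ∀ B ∈ F, P.real (consistent nbr n viol X B (2 * n)) ≤ q ^ B.card := by
    intro B hB
    obtain ⟨D, -, -, h⟩ := consistent_bound hnbr hn hX hm hq.le hb B (2 * n)
    have hB := (Finset.mem_filter.1 hB).1
    rwa [Finset.filter_true_of_mem fun r hr =>
      Finset.mem_range.1 (Finset.mem_powerset.1 hB hr)] at h
  have hsum : ∑ B ∈ F, q ^ B.card ≤ (1 / 2 : ℝ) := by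
    set R := n / (Δ * Δ) + 1 with hR
    have hΔΔ : 0 < Δ * Δ := Nat.mul_pos hΔ hΔ
    have hΔr : (0 : ℝ) < Δ := by exact_mod_cast hΔ
    -- The tilt is chosen so that q z Δ² = 1/2, and the hypothesis on q becomes z ≥ 6.
    set z : ℝ := (2 * q * Δ ^ 2)⁻¹ with hz
    have hz6 : 6 ≤ z := by
      rw [hz, le_inv_comm₀ (by norm_num) (by positivity)]
      linarith
    have hRn : (n : ℝ) ≤ R * Δ ^ 2 := by
      have : n < R * (Δ * Δ) := by
        rw [hR, mul_comm]
        exact Nat.lt_mul_div_succ n hΔΔ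
      have h2 : (n : ℝ) < R * (Δ * Δ) := by exact_mod_cast this
      linarith [h2]
    -- Since z ≥ 1 and |B| ≥ R, inserting z ^ (|B| - R) only increases the terms; the sum may then
    -- run over all subsets, where the binomial theorem evaluates it.
    calc ∑ B ∈ F, q ^ B.card ≤ ∑ B ∈ F, (z ^ R)⁻¹ * (q * z) ^ B.card := by
          refine Finset.sum_le_sum fun B hB => ?_
          have hB := (Finset.mem_filter.1 hB).2
          have : R ≤ B.card := by
            rw [hR, Nat.succ_le_iff]
            exact Nat.div_lt_of_lt_mul (by linarith)
          have h1 : z ^ R ≤ z ^ B.card := pow_le_pow_right₀ (by linarith) this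
          rw [mul_pow, inv_mul_eq_div, le_div_iff₀ (by positivity)]
          gcongr
      _ ≤ ∑ B ∈ (Finset.range (2 * n)).powerset, (z ^ R)⁻¹ * (q * z) ^ B.card := by
          refine Finset.sum_le_sum_of_subset_of_nonneg (Finset.filter_subset _ _) ?_
          intros
          positivity
      _ = (z ^ R)⁻¹ * (q * z + 1) ^ (2 * n) := by
          rw [← Finset.mul_sum]
          congr 1
          simpa using Finset.sum_pow_mul_eq_add_pow (q * z) 1 (Finset.range (2 * n))
      _ ≤ (z ^ R)⁻¹ * 3 ^ R := by
          gcongr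
          have hqz : q * z * Δ ^ 2 = 1 / 2 := by
            rw [hz]
            field_simp
          calc (q * z + 1) ^ (2 * n) ≤ (Real.exp (q * z)) ^ (2 * n) := by
                gcongr
                exact Real.add_one_le_exp _
            _ = Real.exp ((2 * n : ℕ) * (q * z)) := (Real.exp_nat_mul _ _).symm
            _ ≤ Real.exp (R * 1) := by
                refine Real.exp_le_exp.2 ?_
                push_cast
                calc 2 * (n : ℝ) * (q * z) ≤ 2 * (R * Δ ^ 2) * (q * z) := by gcongr
                  _ = R * 1 := by linear_combination (2 * R : ℝ) * hqz
            _ = Real.exp 1 ^ R := Real.exp_nat_mul _ _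
            _ ≤ 3 ^ R := by
                gcongr
                linarith [Real.exp_one_lt_d9]
      _ = (3 / z) ^ R := by rw [div_pow, inv_mul_eq_div]
      _ ≤ (1 / 2) ^ R := by
          gcongr ?_ ^ R
          rw [div_le_div_iff₀ (by positivity) (by norm_num)]
          linarith
      _ ≤ (1 / 2) ^ 1 := pow_le_pow_of_le_one (by norm_num) (by norm_num) (Nat.succ_pos _)
      _ = 1 / 2 := pow_one _
  have hfail : P.real {ω | Succeeds nbr n viol (X · ω)}ᶜ ≤ 1 / 2 :=
    calc _ ≤ P.real (⋃ B ∈ F, consistent nbr n viol X B (2 * n)) :=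
          measureReal_mono hsub (measure_ne_top _ _)
      _ ≤ ∑ B ∈ F, P.real (consistent nbr n viol X B (2 * n)) :=
          measureReal_biUnion_finset_le _ _
      _ ≤ _ := Finset.sum_le_sum hterm
      _ ≤ _ := hsum
  -- Subadditivity suffices here, so measurability of the success event is not needed.
  have hone : (1 : ℝ) ≤ P.real {ω | Succeeds nbr n viol (X · ω)} +
      P.real {ω | Succeeds nbr n viol (X · ω)}ᶜ := by
    have := measureReal_union_le (μ := P) {ω | Succeeds nbr n viol (X · ω)}
      {ω | Succeeds nbr n viol (X · ω)}ᶜ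
    rwa [Set.union_compl_self, probReal_univ] at this
  have hhalf : (1 / 2 : ℝ) ≤ P.real {ω | Succeeds nbr n viol (X · ω)} := by linarith
  rw [← ENNReal.ofReal_toReal (measure_ne_top P _)]
  refine le_trans (le_of_eq ?_) (ENNReal.ofReal_le_ofReal hhalf)
  rw [ENNReal.ofReal_div_of_pos (by norm_num)]
  simp

end LocalResampling

/-! ### Concentration, samples made of coins, and the parameters -/

open MeasureTheory ProbabilityTheory

namespace LocalResampling

variable {Ω : Type*} [MeasurableSpace Ω] {P : Measure Ω} [IsProbabilityMeasure P]

/-- Hoeffding's lemma for a variable in [0, 1]: the variance proxy is (1/2)² = 1/4. -/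
theorem hasSubgaussianMGF_bit {X : Ω → Bool} (hm : Measurable X) :
    HasSubgaussianMGF (fun ω => ((X ω).toNat : ℝ) - P.real {ω | X ω}) (1 / 4) P := by
  have hmeas : Measurable fun ω => ((X ω).toNat : ℝ) :=
    (measurable_of_finite fun b : Bool => (b.toNat : ℝ)).comp hm
  have h := hasSubgaussianMGF_of_mem_Icc (μ := P) (a := 0) (b := 1) hmeas.aemeasurable
    (ae_of_all _ fun ω => by cases X ω <;> simp)
  have hint : ∫ ω, ((X ω).toNat : ℝ) ∂P = P.real {ω | X ω} := by
    have hs : MeasurableSet {ω | X ω = true} := hm (measurableSet_singleton true)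
    rw [← integral_indicator_one hs]
    congr 1
    ext ω
    by_cases h : X ω <;> simp [h]
  rw [hint] at h
  convert h using 1
  ext
  norm_num

/-- Hoeffding's inequality for the number of successes among independent Bernoulli trials. -/
theorem measure_count_ge_le {X : ℕ → Ω → Bool} (hX : iIndepFun X P) (hm : ∀ i, Measurable (X i))
    {p : ℝ} (hp : ∀ i, P.real {ω | X i ω} = p) {Δ : ℕ} (hΔ : 0 < Δ) {I : Finset ℕ}
    (hI : I.card ≤ Δ) {ε : ℝ} (hε : 0 < ε) :
    P.real {ω | Δ * ε ≤ (I.filter fun i => X i ω).card - I.card * p} ≤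
        Real.exp (-2 * Δ * ε ^ 2) ∧
      P.real {ω | Δ * ε ≤ I.card * p - (I.filter fun i => X i ω).card} ≤
        Real.exp (-2 * Δ * ε ^ 2) := by
  have hΔr : (0 : ℝ) < Δ := by exact_mod_cast hΔ
  rcases I.eq_empty_or_nonempty with rfl | hne
  · have : ¬ (Δ * ε ≤ 0) := not_le.2 (by positivity)
    simp [this, Real.exp_nonneg]
  have hcard : (0 : ℝ) < I.card := by exact_mod_cast hne.card_pos
  have hsub : ∀ i ∈ I, HasSubgaussianMGF (fun ω => ((X i ω).toNat : ℝ) - p) (1 / 4) P := by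
    intro i _
    have := hasSubgaussianMGF_bit (P := P) (hm i)
    rwa [hp i] at this
  have hsum : ∀ ω, ∑ i ∈ I, (((X i ω).toNat : ℝ) - p) =
      (I.filter fun i => X i ω).card - I.card * p := by
    intro ω
    rw [Finset.sum_sub_distrib, Finset.sum_const, nsmul_eq_mul, Finset.card_filter]
    push_cast
    congr 1
    refine Finset.sum_congr rfl fun i _ => ?_
    cases X i ω <;> simp
  -- The deviation is measured against Δ while there are only |I| ≤ Δ trials, so fewer trials only
  -- improve the exponent.
  have hexp : Real.exp (-(Δ * ε) ^ 2 / (2 * ∑ i ∈ I, (1 / 4 : NNReal))) ≤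
      Real.exp (-2 * Δ * ε ^ 2) := by
    apply Real.exp_le_exp.2
    rw [Finset.sum_const, nsmul_eq_mul]
    push_cast
    rw [div_le_iff₀ (by positivity)]
    have : (I.card : ℝ) ≤ Δ := by exact_mod_cast hI
    nlinarith [mul_le_mul_of_nonneg_left this (by positivity : 0 ≤ Δ * ε ^ 2)]
  have hmeas : Measurable fun b : Bool => (b.toNat : ℝ) - p := measurable_of_finite _
  have hmeas' : Measurable fun b : Bool => -((b.toNat : ℝ) - p) := measurable_of_finite _
  constructor
  · have h := HasSubgaussianMGF.measure_sum_ge_le_of_iIndepFun (s := I) (c := fun _ => 1 / 4)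
      (hX.comp (fun _ b => (b.toNat : ℝ) - p) fun _ => hmeas) hsub
      (by positivity : 0 ≤ Δ * ε)
    simp only [Function.comp_apply, hsum] at h
    exact h.trans hexp
  · have h := HasSubgaussianMGF.measure_sum_ge_le_of_iIndepFun (s := I) (c := fun _ => 1 / 4)
      (hX.comp (fun _ b => -((b.toNat : ℝ) - p)) fun _ => hmeas')
      (fun i hi => (hsub i hi).neg) (by positivity : 0 ≤ Δ * ε)
    have hsum' : ∀ ω, ∑ i ∈ I, -(((X i ω).toNat : ℝ) - p) =
        I.card * p - (I.filter fun i => X i ω).card := by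
      intro ω
      rw [Finset.sum_neg_distrib, hsum, neg_sub]
    simp only [Function.comp_apply, hsum'] at h
    exact h.trans hexp

/-- The number that is written in binary by the `k` coins of sample `m`. -/
def sampleValue (k : ℕ) (ω : ℕ → Bool) (m : ℕ) : ℕ :=
  ∑ i ∈ Finset.range k, (ω (k * m + i)).toNat * 2 ^ i

/-- Sample `m`, with success probability `j / 2 ^ k`. -/
def sampleBit (k j : ℕ) (m : ℕ) (ω : ℕ → Bool) : Bool :=
  decide (sampleValue k ω m < j)

/-- The map (m, i) ↦ k m + i is injective by division with remainder, so cutting the coin sequence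
into blocks of length k gives independent blocks of independent fair coins. -/
theorem block_law (k : ℕ) :
    WordRAM.coinLaw.map (fun ω (m : ℕ) (i : Fin k) => ω (k * m + i)) =
      Measure.infinitePi fun _ : ℕ => Measure.infinitePi fun _ : Fin k =>
        (PMF.uniformOfFintype Bool).toMeasure := by
  have hinj : Function.Injective fun a : ℕ × Fin k => k * a.1 + (a.2 : ℕ) := by
    rintro ⟨m, i⟩ ⟨m', i'⟩ h
    have hk : 0 < k := i.pos
    have h1 : m = m' := by
      have := congrArg (· / k) h
      simpa [Nat.mul_add_div hk, Nat.div_eq_of_lt i.2, Nat.div_eq_of_lt i'.2] using this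
    subst h1
    simp only [add_right_inj] at h
    rw [Fin.ext h]
  have h1 := Measure.map_infinitePi_infinitePi_of_inj
    (P := fun _ : ℕ => (PMF.uniformOfFintype Bool).toMeasure) hinj
  rw [← Measure.infinitePi_map_curry, ← h1, Measure.map_map (by fun_prop) (by fun_prop)]
  rfl

theorem measurable_block (k m : ℕ) :
    Measurable fun (ω : ℕ → Bool) (i : Fin k) => ω (k * m + i) := by
  fun_prop

theorem sampleBit_eq (k j m : ℕ) (ω : ℕ → Bool) :
    sampleBit k j m ω =
      (fun f : Fin k → Bool => decide (∑ i, (f i).toNat * 2 ^ (i : ℕ) < j))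
        (fun i : Fin k => ω (k * m + i)) := by
  simp only [sampleBit, sampleValue, Finset.sum_range]

theorem measurable_sampleBit (k j m : ℕ) : Measurable (sampleBit k j m) := by
  have : sampleBit k j m = (fun f : Fin k → Bool => decide (∑ i, (f i).toNat * 2 ^ (i : ℕ) < j)) ∘
      fun ω (i : Fin k) => ω (k * m + i) := funext fun ω => sampleBit_eq k j m ω
  rw [this]
  exact (measurable_of_finite _).comp (measurable_block k m)

instance : IsProbabilityMeasure WordRAM.coinLaw := by
  unfold WordRAM.coinLaw
  infer_instance

theorem map_block (k m : ℕ) :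
    WordRAM.coinLaw.map (fun ω (i : Fin k) => ω (k * m + i)) =
      Measure.infinitePi fun _ : Fin k => (PMF.uniformOfFintype Bool).toMeasure := by
  rw [← Measure.infinitePi_map_eval (fun _ : ℕ => Measure.infinitePi fun _ : Fin k =>
        (PMF.uniformOfFintype Bool).toMeasure) m, ← block_law,
    Measure.map_map (by fun_prop) (by fun_prop)]
  rfl

theorem iIndepFun_sampleBit (k j : ℕ) : iIndepFun (sampleBit k j) WordRAM.coinLaw := by
  have h : iIndepFun (fun (m : ℕ) (ω : ℕ → Bool) (i : Fin k) => ω (k * m + i))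
      WordRAM.coinLaw := by
    rw [iIndepFun_iff_map_fun_eq_infinitePi_map (measurable_block k), block_law]
    congr 1
    ext1 m
    exact (map_block k m).symm
  convert h.comp (fun _ f => decide (∑ i, (f i).toNat * 2 ^ (i : ℕ) < j))
    fun _ => measurable_of_finite _ using 1
  ext m ω
  rw [sampleBit_eq]
  rfl

/-- Binary expansion is a bijection from the k-bit strings to the numbers below 2 ^ k. -/
theorem card_binary_lt (k : ℕ) {j : ℕ} (hj : j ≤ 2 ^ k) :
    (Finset.univ.filter fun f : Fin k → Bool => ∑ i, (f i).toNat * 2 ^ (i : ℕ) < j).card = j := by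
  set e : (Fin k → Bool) ≃ Fin (2 ^ k) :=
    (Equiv.arrowCongr (Equiv.refl _) finTwoEquiv.symm).trans finFunctionFinEquiv with he
  have hval : ∀ f, (e f : ℕ) = ∑ i, (f i).toNat * 2 ^ (i : ℕ) := by
    intro f
    simp only [he, Equiv.trans_apply, finFunctionFinEquiv_apply]
    refine Finset.sum_congr rfl fun i _ => ?_
    congr 1
    simp only [Equiv.arrowCongr_apply, Equiv.coe_refl, Function.comp_apply, Equiv.refl_symm, id]
    cases f i <;> rfl
  simp only [← hval]
  rw [← Finset.card_map e.toEmbedding]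
  have : (Finset.univ.filter fun f => (e f : ℕ) < j).map e.toEmbedding =
      Finset.univ.filter fun a : Fin (2 ^ k) => (a : ℕ) < j := by
    ext a
    simp only [Finset.mem_map_equiv, Finset.mem_filter, Finset.mem_univ, true_and,
      Equiv.apply_symm_apply]
  rw [this, Fin.card_filter_val_lt]
  exact min_eq_right hj

theorem measure_sampleBit (k m : ℕ) {j : ℕ} (hj : j ≤ 2 ^ k) :
    WordRAM.coinLaw.real {ω | sampleBit k j m ω} = j / 2 ^ k := by
  set A : Finset (Fin k → Bool) :=
    Finset.univ.filter fun f => ∑ i, (f i).toNat * 2 ^ (i : ℕ) < j with hA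
  have h1 : {ω | sampleBit k j m ω} = (fun ω (i : Fin k) => ω (k * m + i)) ⁻¹' (A : Set _) := by
    ext ω
    simp [sampleBit_eq, hA]
  rw [h1, ← map_measureReal_apply (measurable_block k m) A.measurableSet, map_block,
    Measure.infinitePi_eq_pi, ← sum_measureReal_singleton]
  have h2 : ∀ f ∈ A, (Measure.pi fun _ : Fin k => (PMF.uniformOfFintype Bool).toMeasure).real {f} =
      (1 / 2) ^ k := by
    intro f _
    rw [Measure.real, Measure.pi_singleton, ENNReal.toReal_prod]
    have : ∀ b : Bool, ((PMF.uniformOfFintype Bool).toMeasure {b}).toReal = 1 / 2 := by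
      intro b
      rw [PMF.toMeasure_apply_singleton _ _ (measurableSet_singleton b)]
      simp
    simp only [this, Finset.prod_const, Finset.card_univ, Fintype.card_fin]
  rw [Finset.sum_congr rfl h2, Finset.sum_const, hA, card_binary_lt k hj, nsmul_eq_mul]
  rw [one_div, inv_pow, div_eq_mul_inv]

/-- Whether a vertex of degree `d` with `c` selected neighbours is violated, when the maximum degree
is `D`: it has more than `D / 3` selected neighbours or more than `(1 - a / 2 ^ k) D` others. -/
def viol (k a D c d : ℕ) : Bool :=
  decide (D < 3 * c ∨ (2 ^ k - a) * D < 2 ^ k * (d - c))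

/-- The success probability (a + 1) / 2 ^ k lies 1 / 2 ^ k above a / 2 ^ k and at least as far below
1/3. As the degree is at most Δ, either kind of violation is a deviation of at least Δ / 2 ^ k from
the mean, in one direction or the other. -/
theorem violationBound_viol {k a Δ : ℕ} (hΔ : 0 < Δ) (ha : 3 * (a + 2) ≤ 2 ^ k) :
    ViolationBound WordRAM.coinLaw (viol k a Δ) (sampleBit k (a + 1)) Δ
      (2 * Real.exp (-2 * Δ * (1 / 2 ^ k) ^ 2)) := by
  intro I hI
  have h := measure_count_ge_le (iIndepFun_sampleBit k (a + 1)) (measurable_sampleBit k (a + 1))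
    (p := ((a + 1 : ℕ) : ℝ) / 2 ^ k) (fun m => measure_sampleBit k m (by omega)) hΔ hI
    (ε := 1 / 2 ^ k) (by positivity)
  refine (measureReal_mono (s₂ := _ ∪ _) ?_ (measure_ne_top _ _)).trans
    ((measureReal_union_le _ _).trans ((add_le_add h.1 h.2).trans (two_mul _).symm.le))
  intro ω hω
  set c := (I.filter fun i => sampleBit k (a + 1) i ω).card with hc
  have hcI : c ≤ I.card := Finset.card_filter_le _ _
  have hΔr : (0 : ℝ) < Δ := by exact_mod_cast hΔ
  have hIr : (I.card : ℝ) ≤ Δ := by exact_mod_cast hI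
  have har : (3 : ℝ) * (a + 2) ≤ 2 ^ k := by exact_mod_cast ha
  have hpow : (0 : ℝ) < 2 ^ k := by positivity
  simp only [viol, Set.mem_ofPred_eq, decide_eq_true_eq, ← hc] at hω
  simp only [Set.mem_union, Set.mem_ofPred_eq, ← hc, mul_div_assoc', mul_one, Nat.cast_add,
    Nat.cast_one]
  rcases hω with hω | hω
  · left
    have hω : (Δ : ℝ) < 3 * c := by exact_mod_cast hω
    rw [div_le_iff₀ hpow, sub_mul, div_mul_cancel₀ _ hpow.ne']
    nlinarith [mul_le_mul_of_nonneg_right hIr (by positivity : (0 : ℝ) ≤ a + 1),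
      mul_le_mul_of_nonneg_left har hΔr.le, mul_le_mul_of_nonneg_right hω.le hpow.le]
  · right
    have hω' : (((2 ^ k - a : ℕ) * Δ : ℕ) : ℝ) < (2 ^ k * (I.card - c : ℕ) : ℕ) := by
      exact_mod_cast hω
    push_cast [Nat.cast_sub hcI, Nat.cast_sub (show a ≤ 2 ^ k by omega)] at hω'
    rw [div_le_iff₀ hpow, sub_mul, div_mul_cancel₀ _ hpow.ne']
    nlinarith [mul_nonneg (sub_nonneg.2 hIr)
      (by linarith [(Nat.cast_nonneg a : (0 : ℝ) ≤ a)] : (0 : ℝ) ≤ 2 ^ k - (a + 1))]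

/-- Rounding η up to a multiple of 2 ^ (-k) costs less than one grid step and two more are needed as
slack, so it suffices that three steps fit between η and 1/3. -/
theorem exists_parameters {η : ℝ} (hη₀ : 0 < η) (hη₁ : η < 1 / 3) :
    ∃ k a : ℕ, 3 * (a + 2) ≤ 2 ^ k ∧ η ≤ a / 2 ^ k := by
  obtain ⟨k, hk⟩ := pow_unbounded_of_one_lt (3 / (1 / 3 - η)) (one_lt_two : (1 : ℝ) < 2)
  rw [div_lt_iff₀ (by linarith)] at hk
  have hpow : (0 : ℝ) < 2 ^ k := by positivity
  refine ⟨k, ⌈η * 2 ^ k⌉₊, ?_, ?_⟩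
  · have := Nat.ceil_lt_add_one (mul_pos hη₀ hpow).le
    have : (3 : ℝ) * (⌈η * 2 ^ k⌉₊ + 2) ≤ 2 ^ k := by nlinarith
    exact_mod_cast this
  · rw [le_div_iff₀ hpow]
    exact Nat.le_ceil _

theorem exists_degree_bound (k : ℕ) :
    ∃ C : ℕ, 0 < C ∧ ∀ Δ : ℕ, C ≤ Δ →
      12 * (Δ : ℝ) ^ 2 * (2 * Real.exp (-2 * Δ * (1 / 2 ^ k) ^ 2)) ≤ 1 := by
  have h := (tendsto_rpow_mul_exp_neg_mul_atTop_nhds_zero 2 (2 * (1 / 2 ^ k) ^ 2)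
    (by positivity)).comp tendsto_natCast_atTop_atTop
  -- The threshold 1/24 is the factor 12 of the union bound times the 2 from the two tails.
  have h := h.eventually (ge_mem_nhds (by norm_num : (0 : ℝ) < 1 / 24))
  obtain ⟨C, hC⟩ := Filter.eventually_atTop.1 h
  refine ⟨C + 1, by omega, fun Δ hΔ => ?_⟩
  have := hC Δ (by omega)
  simp only [Function.comp_apply, Real.rpow_two] at this
  have heq : -2 * (Δ : ℝ) * (1 / 2 ^ k) ^ 2 = -(2 * (1 / 2 ^ k) ^ 2) * Δ := by ring
  rw [heq]
  linarith

/-- The run succeeds with probability at least one half. -/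
theorem half_le_coinLaw_succeeds {n Δ k a : ℕ} {nbr : ℕ → List ℕ} (hnbr : IsNbr n Δ nbr)
    (hn : 0 < n) (hΔ : 0 < Δ) (ha : 3 * (a + 2) ≤ 2 ^ k)
    (hC : 12 * (Δ : ℝ) ^ 2 * (2 * Real.exp (-2 * Δ * (1 / 2 ^ k) ^ 2)) ≤ 1) :
    1 / 2 ≤ WordRAM.coinLaw
      {ω | Succeeds nbr n (viol k a Δ) fun m => sampleBit k (a + 1) m ω} :=
  half_le_measure_succeeds hnbr hn hΔ (iIndepFun_sampleBit k (a + 1))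
    (measurable_sampleBit k (a + 1)) (by positivity) hC (violationBound_viol hΔ ha)

end LocalResampling

/-! ### A program logic for total correctness with running times -/

namespace WordRAM

/-- Set register `x` to `a`. -/
def State.setReg (σ : State) (x a : ℕ) : State :=
  { σ with reg := Function.update σ.reg x a }

/-- Set cell `i` of array `a` to `b`. -/
def State.setCell (σ : State) (a i b : ℕ) : State :=
  { σ with arr := Function.update σ.arr a (Function.update (σ.arr a) i b) }

/-- Record that one more coin has been tossed. -/
def State.advance (σ : State) : State :=
  { σ with tossed := σ.tossed + 1 }

@[simp] theorem State.setReg_reg (σ : State) (x a y : ℕ) :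
    (σ.setReg x a).reg y = if y = x then a else σ.reg y := by
  simp [State.setReg, Function.update_apply]

@[simp] theorem State.setReg_arr (σ : State) (x a : ℕ) : (σ.setReg x a).arr = σ.arr := rfl

@[simp] theorem State.setReg_tossed (σ : State) (x a : ℕ) :
    (σ.setReg x a).tossed = σ.tossed := rfl

@[simp] theorem State.setCell_reg (σ : State) (a i b : ℕ) : (σ.setCell a i b).reg = σ.reg := rfl

@[simp] theorem State.setCell_arr (σ : State) (a i b c : ℕ) :
    (σ.setCell a i b).arr c = if c = a then Function.update (σ.arr a) i b else σ.arr c := by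
  simp [State.setCell, Function.update_apply]

@[simp] theorem State.setCell_tossed (σ : State) (a i b : ℕ) :
    (σ.setCell a i b).tossed = σ.tossed := rfl

@[simp] theorem State.advance_reg (σ : State) : σ.advance.reg = σ.reg := rfl

@[simp] theorem State.advance_arr (σ : State) : σ.advance.arr = σ.arr := rfl

@[simp] theorem State.advance_tossed (σ : State) : σ.advance.tossed = σ.tossed + 1 := rfl

/-- The program `p` started in `σ` halts, and its running time and final state satisfy `Q`. -/
def Halts (w : ℕ) (ω : ℕ → Bool) (p : Prog) (Q : ℕ → State → Prop) (σ : State) : Prop :=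
  ∃ t σ', Exec w ω p σ t σ' ∧ Q t σ'

variable {w : ℕ} {ω : ℕ → Bool} {p q : Prog} {e : Expr} {Q : ℕ → State → Prop} {σ : State}

theorem Halts.mono {Q' : ℕ → State → Prop} (h : Halts w ω p Q σ)
    (hQ : ∀ t σ', Q t σ' → Q' t σ') : Halts w ω p Q' σ := by
  obtain ⟨t, σ', h, hq⟩ := h
  exact ⟨t, σ', h, hQ t σ' hq⟩

theorem halts_skip (h : Q 1 σ) : Halts w ω .skip Q σ := ⟨_, _, .skip σ, h⟩

theorem halts_assign {x : ℕ} (a : ℕ) (ha : e.eval w σ = a) (h : Q (e.cost + 1) (σ.setReg x a)) :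
    Halts w ω (.assign x e) Q σ := by
  subst ha
  exact ⟨_, _, .assign σ x e, h⟩

theorem halts_store {a : ℕ} {i : Expr} (j b : ℕ) (hj : i.eval w σ = j) (hb : e.eval w σ = b)
    (h : Q (i.cost + e.cost + 1) (σ.setCell a j b)) : Halts w ω (.store a i e) Q σ := by
  subst hj hb
  exact ⟨_, _, .store σ a i e, h⟩

theorem halts_toss {x : ℕ} (h : Q 1 ((σ.setReg x (ω σ.tossed).toNat).advance)) :
    Halts w ω (.toss x) Q σ := by
  refine ⟨_, _, .toss σ x, ?_⟩
  convert h using 1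
  ext y
  · simp [State.advance, State.setReg, Bool.toNat, Bool.cond_eq_ite]
  · rfl
  · rfl

/-- The time spent so far is passed into the postcondition of the second program, so proofs can
follow a program forwards as with weakest preconditions. -/
theorem halts_seq (h : Halts w ω p (fun s => Halts w ω q fun t => Q (s + t)) σ) :
    Halts w ω (.seq p q) Q σ := by
  obtain ⟨s, σ₁, hp, t, σ₂, hq, h⟩ := h
  exact ⟨_, _, .seq hp hq, h⟩

theorem halts_cond (h₁ : e.eval w σ ≠ 0 → Halts w ω p (fun t => Q (e.cost + 1 + t)) σ)
    (h₀ : e.eval w σ = 0 → Halts w ω q (fun t => Q (e.cost + 1 + t)) σ) :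
    Halts w ω (.cond e p q) Q σ := by
  by_cases he : e.eval w σ = 0
  · obtain ⟨t, σ', h, hQ⟩ := h₀ he
    exact ⟨_, _, .cond_false p he h, hQ⟩
  · obtain ⟨t, σ', h, hQ⟩ := h₁ he
    exact ⟨_, _, .cond_true q he h, hQ⟩

/-- A loop with invariant `I`, at most `N` iterations, and running time accounted by `Φ`. -/
theorem halts_loop (I : ℕ → State → Prop) (Φ : ℕ → ℕ) (N : ℕ) (h0 : I 0 σ)
    (hN : ∀ t σ, I t σ → e.eval w σ ≠ 0 → t < N)
    (hstep : ∀ t σ, I t σ → e.eval w σ ≠ 0 →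
      Halts w ω p (fun s σ' => I (t + 1) σ' ∧ Φ t + (e.cost + 1 + s) ≤ Φ (t + 1)) σ)
    (hQ : ∀ t T σ', I t σ' → e.eval w σ' = 0 → Φ 0 + T ≤ Φ t + (e.cost + 1) → Q T σ') :
    Halts w ω (.loop e p) Q σ := by
  -- Induction on a bound m for the number N - t of iterations left. The potential telescopes, and
  -- only the last, failing test of the guard stays unpaid.
  have key : ∀ m t σ, N - t ≤ m → I t σ → ∃ t' T σ', Exec w ω (.loop e p) σ T σ' ∧ I t' σ' ∧
      e.eval w σ' = 0 ∧ Φ t + T ≤ Φ t' + (e.cost + 1) := by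
    intro m
    induction m with
    | zero =>
      intro t σ hm hI
      by_cases he : e.eval w σ = 0
      · exact ⟨t, _, σ, .loop_false p he, hI, he, le_rfl⟩
      · have := hN t σ hI he
        omega
    | succ m ih =>
      intro t σ hm hI
      by_cases he : e.eval w σ = 0
      · exact ⟨t, _, σ, .loop_false p he, hI, he, le_rfl⟩
      · have := hN t σ hI he
        obtain ⟨s, σ₁, hs, hI₁, hΦ⟩ := hstep t σ hI he
        obtain ⟨t', T, σ', hT, hI', he', hΦ'⟩ := ih (t + 1) σ₁ (by omega) hI₁
        exact ⟨t', _, σ', .loop_true he hs hT, hI', he', by omega⟩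
  obtain ⟨t', T, σ', hT, hI', he', hΦ⟩ := key N 0 σ (by omega) h0
  exact ⟨T, σ', hT, hQ t' T σ' hI' he' hΦ⟩

/-- A loop with `N` iterations and running time accounted by `Φ`. -/
theorem halts_for (I : ℕ → State → Prop) (Φ : ℕ → ℕ) (N : ℕ) (h0 : I 0 σ)
    (he : ∀ t ≤ N, ∀ σ, I t σ → e.eval w σ = if t < N then 1 else 0)
    (hstep : ∀ t < N, ∀ σ, I t σ →
      Halts w ω p (fun s σ' => I (t + 1) σ' ∧ Φ t + (e.cost + 1 + s) ≤ Φ (t + 1)) σ)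
    (hQ : ∀ T σ', I N σ' → Φ 0 + T ≤ Φ N + (e.cost + 1) → Q T σ') :
    Halts w ω (.loop e p) Q σ := by
  refine halts_loop (fun t σ => I t σ ∧ t ≤ N) Φ N ⟨h0, Nat.zero_le _⟩ ?_ ?_ ?_
  · rintro t σ ⟨hI, ht⟩ h
    rw [he t ht σ hI] at h
    by_contra hcon
    simp [hcon] at h
  · rintro t σ ⟨hI, ht⟩ h
    have ht' : t < N := by
      rw [he t ht σ hI] at h
      by_contra hcon
      simp [hcon] at h
    exact (hstep t ht' σ hI).mono fun s σ' h => ⟨⟨h.1, ht'⟩, h.2⟩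
  · rintro t T σ' ⟨hI, ht⟩ h hΦ
    have : t = N := by
      rw [he t ht σ' hI] at h
      by_contra hcon
      have : t < N := by omega
      simp [this] at h
    subst this
    exact hQ T σ' hI hΦ

theorem eval_add {e₁ e₂ : Expr} (h : e₁.eval w σ + e₂.eval w σ < 2 ^ w) :
    (Expr.op .add e₁ e₂).eval w σ = e₁.eval w σ + e₂.eval w σ :=
  Nat.mod_eq_of_lt h

theorem eval_sub {e₁ e₂ : Expr} (h : e₁.eval w σ - e₂.eval w σ < 2 ^ w) :
    (Expr.op .sub e₁ e₂).eval w σ = e₁.eval w σ - e₂.eval w σ :=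
  Nat.mod_eq_of_lt h

theorem eval_mul {e₁ e₂ : Expr} (h : e₁.eval w σ * e₂.eval w σ < 2 ^ w) :
    (Expr.op .mul e₁ e₂).eval w σ = e₁.eval w σ * e₂.eval w σ :=
  Nat.mod_eq_of_lt h

theorem eval_lt {e₁ e₂ : Expr} (h : 1 < 2 ^ w) :
    (Expr.op .lt e₁ e₂).eval w σ = if e₁.eval w σ < e₂.eval w σ then 1 else 0 := by
  refine Nat.mod_eq_of_lt ?_
  split_ifs <;> omega

theorem eval_const {c : ℕ} (h : c < 2 ^ w) : (Expr.const c).eval w σ = c := Nat.mod_eq_of_lt h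

@[simp] theorem eval_reg (x : ℕ) : (Expr.reg x).eval w σ = σ.reg x := rfl

@[simp] theorem eval_cell (a : ℕ) : (Expr.cell a e).eval w σ = σ.arr a (e.eval w σ) := rfl

end WordRAM

/-! ### The program and its subroutines -/

namespace WordRAM

open LocalResampling WordRAM.Expr WordRAM.BinOp

/-- Increment register `x`. -/
def inc (x : ℕ) : Prog := .assign x (op add (reg x) (const 1))

/-- Toss `k` coins and put the number they write in binary into register `3`. -/
def draw : ℕ → Prog
  | 0 => .assign 3 (const 0)
  | k + 1 => .seq (draw k) (.seq (.toss 4)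
      (.assign 3 (op add (reg 3) (op mul (reg 4) (const (2 ^ k))))))

/-- Put the maximum degree into register `1`. -/
def scanDegrees : Prog :=
  .seq (.assign 2 (const 0)) (.loop (op lt (reg 2) (reg 0))
    (.seq (.assign 3 (op sub (cell 0 (op add (reg 2) (const 1))) (cell 0 (reg 2))))
      (.seq (.cond (op lt (reg 1) (reg 3)) (.assign 1 (reg 3)) .skip) (inc 2))))

/-- Draw a sample for every vertex, and queue all vertices. -/
def sampleAll (k a : ℕ) : Prog :=
  .seq (.assign 2 (const 0)) (.seq (.loop (op lt (reg 2) (reg 0))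
    (.seq (draw k) (.seq (.store 2 (reg 2) (op lt (reg 3) (const (a + 1))))
      (.seq (.store 3 (reg 2) (reg 2)) (inc 2)))))
    (.seq (.assign 5 (reg 0)) (.assign 6 (const 0))))

/-- Append the list of the neighbours of the vertex in register `11` to the queue. -/
def appendNbrs : Prog :=
  .seq (.assign 12 (cell 0 (reg 11))) (.seq (.assign 13 (cell 0 (op add (reg 11) (const 1))))
    (.loop (op lt (reg 12) (reg 13))
      (.seq (.store 3 (reg 5) (cell 1 (reg 12))) (.seq (inc 5) (inc 12)))))

/-- Count the selected neighbours of the vertex in register `7`. -/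
def countSelected : Prog :=
  .seq (.assign 8 (cell 0 (op add (reg 7) (const 1)))) (.seq (.assign 9 (cell 0 (reg 7)))
    (.seq (.assign 10 (const 0)) (.loop (op lt (reg 9) (reg 8))
      (.seq (.assign 10 (op add (reg 10) (cell 2 (cell 1 (reg 9))))) (inc 9)))))

/-- Resample the neighbours of the vertex in register `7`. -/
def resampleNbrs (k a : ℕ) : Prog :=
  .seq (.assign 9 (cell 0 (reg 7))) (.loop (op lt (reg 9) (reg 8))
    (.seq (.assign 11 (cell 1 (reg 9))) (.seq (draw k)
      (.seq (.store 2 (reg 11) (op lt (reg 3) (const (a + 1)))) (.seq appendNbrs (inc 9))))))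

/-- Whether the vertex in register `7` is violated. -/
def violatedTest (k a : ℕ) : Expr :=
  op add (op lt (reg 1) (op mul (const 3) (reg 10)))
    (op lt (op mul (const (2 ^ k - a)) (reg 1))
      (op mul (const (2 ^ k)) (op sub (op sub (reg 8) (cell 0 (reg 7))) (reg 10))))

/-- Process the queue. -/
def processQueue (k a : ℕ) : Prog :=
  .loop (op mul (op lt (reg 6) (reg 5)) (op lt (reg 5) (op add (op mul (const 2) (reg 0)) (const 1))))
    (.seq (.assign 7 (cell 3 (reg 6))) (.seq (inc 6) (.seq countSelected
      (.cond (violatedTest k a) (resampleNbrs k a) .skip))))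

/-- The program that looks for a seeding set. -/
def seedingProg (k a : ℕ) : Prog :=
  .seq scanDegrees (.seq (sampleAll k a) (processQueue k a))

/-- Words of `w` bits are long enough for the numbers that occur. -/
structure Fits (w k n : ℕ) : Prop where
  pow : 2 ^ k * (n + 1) < 2 ^ w
  sq : n * n + 4 * n + 4 < 2 ^ w

/-- The arrays `A₀` and `A₁` store the adjacency lists `nbr`. -/
structure Layout (n Δ : ℕ) (nbr : ℕ → List ℕ) (A₀ A₁ : ℕ → ℕ) : Prop where
  isNbr : IsNbr n Δ nbr
  pos : 0 < n
  le : Δ ≤ n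
  start_succ : ∀ v < n, A₀ (v + 1) = A₀ v + (nbr v).length
  start_le : ∀ v ≤ n, A₀ v ≤ n * n
  getElem : ∀ v < n, ∀ i (h : i < (nbr v).length), A₁ (A₀ v + i) = (nbr v)[i]

/-- The state holds the graph, the selected set `f`, and the queue `q`, and `c` samples have been
drawn. -/
structure Rep (A₀ A₁ : ℕ → ℕ) (n Δ k c : ℕ) (f : ℕ → Bool) (q : List ℕ) (σ : State) : Prop where
  size : σ.reg 0 = n
  deg : σ.reg 1 = Δ
  len : σ.reg 5 = q.length
  start : σ.arr 0 = A₀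
  adj : σ.arr 1 = A₁
  bits : ∀ v < n, σ.arr 2 v = (f v).toNat
  queue : ∀ i (h : i < q.length), σ.arr 3 i = q[i]
  tossed : σ.tossed = k * c

variable {w k a n Δ c : ℕ} {ω : ℕ → Bool} {nbr : ℕ → List ℕ} {A₀ A₁ : ℕ → ℕ} {f : ℕ → Bool}
  {q : List ℕ} {σ : State} {Q : ℕ → State → Prop}

theorem Rep.setReg (h : Rep A₀ A₁ n Δ k c f q σ) {x y : ℕ} (h0 : x ≠ 0) (h1 : x ≠ 1)
    (h5 : x ≠ 5) : Rep A₀ A₁ n Δ k c f q (σ.setReg x y) := by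
  obtain ⟨a1, a2, a3, a4, a5, a6, a7, a8⟩ := h
  constructor <;> simp_all [h0.symm, h1.symm, h5.symm]

theorem halts_inc {x : ℕ} (hx : σ.reg x + 1 < 2 ^ w) (h : Q 4 (σ.setReg x (σ.reg x + 1))) :
    Halts w ω (inc x) Q σ := by
  refine halts_assign (σ.reg x + 1) ?_ h
  have h1 : (const 1).eval w σ = 1 := eval_const (by omega)
  rw [eval_add] <;> rw [h1]
  · rfl
  · exact hx

theorem sum_bits_lt (g : ℕ → Bool) (k : ℕ) :
    ∑ j ∈ Finset.range k, (g j).toNat * 2 ^ j < 2 ^ k := by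
  induction k with
  | zero => simp
  | succ k ih =>
    rw [Finset.sum_range_succ, pow_succ]
    have : (g k).toNat * 2 ^ k ≤ 2 ^ k := by cases g k <;> simp
    omega

/-- The coins come lowest bit first, in the order of `sampleValue`. All partial sums stay below 2 ^
k, so nothing wraps around. -/
theorem halts_draw (hk : 2 ^ k < 2 ^ w) :
    Halts w ω (draw k) (fun t σ' => t ≤ 7 * k + 2 ∧
      σ'.reg 3 = ∑ j ∈ Finset.range k, (ω (σ.tossed + j)).toNat * 2 ^ j ∧ σ'.arr = σ.arr ∧
      σ'.tossed = σ.tossed + k ∧ ∀ y, y ≠ 3 → y ≠ 4 → σ'.reg y = σ.reg y) σ := by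
  induction k with
  | zero =>
    refine halts_assign 0 (eval_const (by omega)) ?_
    simp +contextual [Expr.cost]
  | succ k ih =>
    have hlt : 2 ^ k < 2 ^ w := by rw [pow_succ] at hk; omega
    refine halts_seq ((ih hlt).mono ?_)
    rintro t σ₁ ⟨ht, h3, harr, htoss, hreg⟩
    refine halts_seq (halts_toss ?_)
    set s := ∑ j ∈ Finset.range k, (ω (σ.tossed + j)).toNat * 2 ^ j with hs
    have hs' := sum_bits_lt (fun j => ω (σ.tossed + j)) (k + 1)
    rw [Finset.sum_range_succ] at hs'
    set σ₂ := (σ₁.setReg 4 (ω σ₁.tossed).toNat).advance with hσ₂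
    have e1 : (const (2 ^ k)).eval w σ₂ = 2 ^ k := eval_const hlt
    have e2 : (op mul (reg 4) (const (2 ^ k))).eval w σ₂ = (ω σ₁.tossed).toNat * 2 ^ k := by
      rw [eval_mul] <;> rw [e1]
      · simp [hσ₂]
      · simp only [hσ₂, eval_reg, State.advance_reg, State.setReg_reg, if_true, htoss]
        omega
    have e3 : (reg 3).eval w σ₂ = s := by simp [hσ₂, h3]
    refine halts_assign (s + (ω (σ.tossed + k)).toNat * 2 ^ k) ?_ ?_
    · rw [eval_add] <;> rw [e2, e3, htoss]
      omega
    · refine ⟨?_, ?_, ?_, ?_, ?_⟩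
      · simp only [Expr.cost]
        omega
      · simp [Finset.sum_range_succ, hs]
      · simp [hσ₂, harr]
      · simp [hσ₂, htoss]
        omega
      · intro y hy3 hy4
        simp [hσ₂, hy3, hy4, hreg]

/-- Drawing sample `c`. -/
theorem Rep.halts_draw (h : Rep A₀ A₁ n Δ k c f q σ) (hk : 2 ^ k < 2 ^ w) (ha : a < 2 ^ k) :
    Halts w ω (draw k) (fun t σ' => t ≤ 7 * k + 2 ∧ Rep A₀ A₁ n Δ k (c + 1) f q σ' ∧
      (op lt (reg 3) (const (a + 1))).eval w σ' = (sampleBit k (a + 1) c ω).toNat ∧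
      ∀ y, y ≠ 3 → y ≠ 4 → σ'.reg y = σ.reg y) σ := by
  refine (WordRAM.halts_draw hk).mono ?_
  rintro t σ' ⟨ht, h3, harr, htoss, hreg⟩
  refine ⟨ht, ⟨?_, ?_, ?_, ?_, ?_, ?_, ?_, ?_⟩, ?_, hreg⟩
  · rw [hreg 0 (by decide) (by decide), h.size]
  · rw [hreg 1 (by decide) (by decide), h.deg]
  · rw [hreg 5 (by decide) (by decide), h.len]
  · rw [harr, h.start]
  · rw [harr, h.adj]
  · rw [harr]; exact h.bits
  · rw [harr]; exact h.queue
  · rw [htoss, h.tossed, mul_add, mul_one]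
  · rw [eval_lt (by omega), eval_const (by omega), eval_reg, h3, h.tossed]
    simp only [sampleBit, sampleValue]
    split_ifs with hlt <;> simp [hlt]

theorem Layout.length_le (hL : Layout n Δ nbr A₀ A₁) {v : ℕ} (hv : v < n) :
    (nbr v).length ≤ n := (hL.isNbr.length_le v hv).trans hL.le

theorem halts_appendNbrs (hL : Layout n Δ nbr A₀ A₁) (hF : Fits w k n)
    (h : Rep A₀ A₁ n Δ k c f q σ) {u : ℕ} (hu : u < n) (h11 : σ.reg 11 = u)
    (hlen : q.length + (nbr u).length ≤ 2 * n + n * n) :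
    Halts w ω appendNbrs (fun t σ' => t ≤ 16 * (nbr u).length + 13 ∧
      Rep A₀ A₁ n Δ k c f (q ++ nbr u) σ' ∧
      ∀ y, y ≠ 5 → y ≠ 12 → y ≠ 13 → σ'.reg y = σ.reg y) σ := by
  have hsq := hF.sq
  have hend := hL.start_succ u hu
  have hend' := hL.start_le (u + 1) hu
  refine halts_seq (halts_assign (A₀ u) (by simp [h.start, h11]) ?_)
  refine halts_seq (halts_assign (A₀ (u + 1)) ?_ ?_)
  · rw [eval_cell, eval_add] <;> rw [eval_const (by omega)]
    · simp [h.start, h11]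
    · simp [h11]; omega
  refine halts_for (fun i σ' => Rep A₀ A₁ n Δ k c f (q ++ (nbr u).take i) σ' ∧
      σ'.reg 12 = A₀ u + i ∧ σ'.reg 13 = A₀ (u + 1) ∧
      ∀ y, y ≠ 5 → y ≠ 12 → y ≠ 13 → σ'.reg y = σ.reg y) (fun i => 16 * i) (nbr u).length
    ⟨?_, ?_, ?_, ?_⟩ ?_ ?_ ?_
  · simpa using (h.setReg (by decide) (by decide) (by decide)).setReg
      (by decide) (by decide) (by decide)
  · simp
  · simp
  · intro y h5 h12 h13
    simp [h12, h13]
  · rintro i hi σ' ⟨hr, h12, h13, -⟩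
    rw [eval_lt (by omega)]
    simp [h12, h13, hend]
  · rintro i hi σ' ⟨hr, h12, h13, hreg⟩
    have hrl := hr.len
    rw [List.length_append, List.length_take_of_le hi.le] at hrl
    refine halts_seq (halts_store (q.length + i) ((nbr u)[i]) (by simpa using hrl) ?_ ?_)
    · simp [hr.adj, h12, hL.getElem u hu i hi]
    refine halts_seq (halts_inc (by simp; omega) (halts_inc (by simp; omega) ?_))
    have htake : (nbr u).take (i + 1) = (nbr u).take i ++ [(nbr u)[i]] := by simp
    refine ⟨⟨⟨?_, ?_, ?_, ?_, ?_, ?_, ?_, ?_⟩, ?_, ?_, ?_⟩, ?_⟩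
    · simp [hr.size]
    · simp [hr.deg]
    · simp [hrl, hi]
      omega
    · simp [hr.start]
    · simp [hr.adj]
    · simpa using hr.bits
    · intro j hj
      have hj' : j < q.length + (i + 1) := by
        simpa only [List.length_append, List.length_take_of_le hi] using hj
      simp only [State.setReg_arr, State.setCell_arr, if_true]
      by_cases hji : j = q.length + i
      · subst hji
        simp
      · have hlt : j < (q ++ (nbr u).take i).length := by
          rw [List.length_append, List.length_take_of_le hi.le]
          omega
        rw [Function.update_of_ne hji, hr.queue j hlt]
        simp only [htake, ← List.append_assoc]
        rw [List.getElem_append_left hlt]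
    · simp [hr.tossed]
    · simp [h12]
      omega
    · simp [h13]
    · intro y h5 h12 h13
      simp [h5, h12, hreg y h5 h12 h13]
    · simp only [Expr.cost]
      omega
  · rintro T σ' ⟨hr, -, -, hreg⟩ hT
    rw [List.take_length] at hr
    refine ⟨?_, hr, hreg⟩
    simp only [Expr.cost] at hT ⊢
    omega

theorem halts_countSelected (hL : Layout n Δ nbr A₀ A₁) (hF : Fits w k n)
    (h : Rep A₀ A₁ n Δ k c f q σ) {v : ℕ} (hv : v < n) (h7 : σ.reg 7 = v) :
    Halts w ω countSelected (fun t σ' => t ≤ 16 * (nbr v).length + 15 ∧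
      Rep A₀ A₁ n Δ k c f q σ' ∧ σ'.reg 8 = A₀ (v + 1) ∧ σ'.reg 10 = (nbr v).countP f ∧
      ∀ y, y ≠ 8 → y ≠ 9 → y ≠ 10 → σ'.reg y = σ.reg y) σ := by
  have hsq := hF.sq
  have hend := hL.start_succ v hv
  have hend' := hL.start_le (v + 1) hv
  have hnl := hL.length_le hv
  refine halts_seq (halts_assign (A₀ (v + 1)) ?_ ?_)
  · rw [eval_cell, eval_add] <;> rw [eval_const (by omega)]
    · simp [h.start, h7]
    · simp [h7]; omega
  refine halts_seq (halts_assign (A₀ v) (by simp [h.start, h7]) ?_)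
  refine halts_seq (halts_assign 0 (eval_const (by omega)) ?_)
  refine halts_for (fun i σ' => Rep A₀ A₁ n Δ k c f q σ' ∧ σ'.reg 8 = A₀ (v + 1) ∧
      σ'.reg 9 = A₀ v + i ∧ σ'.reg 10 = ((nbr v).take i).countP f ∧
      ∀ y, y ≠ 8 → y ≠ 9 → y ≠ 10 → σ'.reg y = σ.reg y) (fun i => 16 * i) (nbr v).length
    ⟨?_, ?_, ?_, ?_, ?_⟩ ?_ ?_ ?_
  · exact ((h.setReg (by decide) (by decide) (by decide)).setReg
      (by decide) (by decide) (by decide)).setReg (by decide) (by decide) (by decide)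
  · simp
  · simp
  · simp
  · intro y h8 h9 h10
    simp [h8, h9, h10]
  · rintro i hi σ' ⟨hr, h8, h9, -⟩
    rw [eval_lt (by omega)]
    simp [h8, h9, hend]
  · rintro i hi σ' ⟨hr, h8, h9, h10, hreg⟩
    have htake : (nbr v).take (i + 1) = (nbr v).take i ++ [(nbr v)[i]] := by simp
    have hcount : ((nbr v).take (i + 1)).countP f =
        ((nbr v).take i).countP f + (f (nbr v)[i]).toNat := by
      rw [htake, List.countP_append, List.countP_singleton]
      cases f (nbr v)[i] <;> simp
    have hcl : ((nbr v).take (i + 1)).countP f ≤ n :=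
      List.countP_le_length.trans ((List.length_take_le _ _).trans (by omega))
    have hcell : (cell 2 (cell 1 (reg 9))).eval w σ' = (f (nbr v)[i]).toNat := by
      simp only [eval_cell, eval_reg, hr.adj, h9, hL.getElem v hv i hi]
      exact hr.bits _ (hL.isNbr.lt v hv _ (List.getElem_mem hi))
    refine halts_seq (halts_assign (((nbr v).take (i + 1)).countP f) ?_ ?_)
    · rw [eval_add] <;> rw [hcell, eval_reg, h10, ← hcount]
      omega
    refine halts_inc (by simp; omega) ⟨⟨?_, ?_, ?_, ?_, ?_⟩, ?_⟩
    · exact (hr.setReg (by decide) (by decide) (by decide)).setReg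
        (by decide) (by decide) (by decide)
    · simp [h8]
    · simp [h9]
      omega
    · simp
    · intro y h8 h9 h10
      simp [h9, h10, hreg y h8 h9 h10]
    · simp only [Expr.cost]
      omega
  · rintro T σ' ⟨hr, h8, -, h10, hreg⟩ hT
    rw [List.take_length] at h10
    refine ⟨?_, hr, h8, h10, hreg⟩
    simp only [Expr.cost] at hT ⊢
    omega

/-- The sum of the two comparison bits acts as a disjunction. Clearing the denominator 2 ^ k keeps
the test in integers, and `Fits` keeps the products below the word size. -/
theorem eval_violatedTest (hL : Layout n Δ nbr A₀ A₁) (hF : Fits w k n)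
    (h : Rep A₀ A₁ n Δ k c f q σ) {v : ℕ} (hv : v < n) (h7 : σ.reg 7 = v)
    (h8 : σ.reg 8 = A₀ (v + 1)) (h10 : σ.reg 10 = (nbr v).countP f) :
    (violatedTest k a).eval w σ ≠ 0 ↔ viol k a Δ ((nbr v).countP f) (nbr v).length := by
  have hsq := hF.sq
  have hpow := hF.pow
  have hle := hL.le
  have hnl := hL.length_le hv
  have hcl : (nbr v).countP f ≤ (nbr v).length := List.countP_le_length
  have hpow' : 2 ^ k < 2 ^ w := by nlinarith [Nat.one_le_two_pow (n := k)]
  have hend := hL.start_succ v hv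
  set C := (nbr v).countP f with hC
  set d := (nbr v).length with hd
  have e1 : (op mul (const 3) (reg 10)).eval w σ = 3 * C := by
    rw [eval_mul] <;> rw [eval_const (by omega), eval_reg, h10]
    omega
  have e2 : (op mul (const (2 ^ k - a)) (reg 1)).eval w σ = (2 ^ k - a) * Δ := by
    rw [eval_mul] <;> rw [eval_const ((Nat.sub_le _ _).trans_lt hpow'), eval_reg, h.deg]
    calc (2 ^ k - a) * Δ ≤ 2 ^ k * (n + 1) := Nat.mul_le_mul (Nat.sub_le _ _) (by omega)
      _ < 2 ^ w := hpow
  have e3 : (op sub (reg 8) (cell 0 (reg 7))).eval w σ = d := by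
    have : (reg 8).eval w σ - (cell 0 (reg 7)).eval w σ = d := by
      simp [h8, h.start, h7, hend]
    rw [eval_sub] <;> rw [this]
    omega
  have e4 : (op sub (op sub (reg 8) (cell 0 (reg 7))) (reg 10)).eval w σ = d - C := by
    rw [eval_sub] <;> rw [e3, eval_reg, h10]
    omega
  have e5 : (op mul (const (2 ^ k)) (op sub (op sub (reg 8) (cell 0 (reg 7))) (reg 10))).eval w σ =
      2 ^ k * (d - C) := by
    rw [eval_mul] <;> rw [eval_const hpow', e4]
    calc 2 ^ k * (d - C) ≤ 2 ^ k * (n + 1) := Nat.mul_le_mul le_rfl (by omega)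
      _ < 2 ^ w := hpow
  have e6 := eval_lt (w := w) (σ := σ) (e₁ := reg 1) (e₂ := op mul (const 3) (reg 10)) (by omega)
  have e7 := eval_lt (w := w) (σ := σ) (e₁ := op mul (const (2 ^ k - a)) (reg 1))
    (e₂ := op mul (const (2 ^ k)) (op sub (op sub (reg 8) (cell 0 (reg 7))) (reg 10))) (by omega)
  rw [e1, eval_reg, h.deg] at e6
  rw [e2, e5] at e7
  rw [violatedTest, eval_add] <;> rw [e6, e7]
  · simp only [viol, decide_eq_true_eq]
    split_ifs with h1 h2 h2 <;> simp [h1, h2]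
  · split_ifs <;> omega

end WordRAM

/-! ### Simulation of the run by the program -/

namespace WordRAM

open LocalResampling WordRAM.Expr WordRAM.BinOp

variable {w k a n Δ c : ℕ} {ω : ℕ → Bool} {nbr : ℕ → List ℕ} {A₀ A₁ : ℕ → ℕ} {f : ℕ → Bool}
  {q : List ℕ} {σ : State} {Q : ℕ → State → Prop}

/-- The state holds the configuration `s` of the run on the samples that `ω` provides. -/
def Holds (A₀ A₁ : ℕ → ℕ) (n Δ k a : ℕ) (ω : ℕ → Bool) (s : Config) (σ : State) : Prop :=
  Rep A₀ A₁ n Δ k s.used (fun v => sampleBit k (a + 1) (s.slot v) ω) s.queue σ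

theorem Rep.setBit {f' : ℕ → Bool} {u : ℕ} (h : Rep A₀ A₁ n Δ k c f q σ)
    (hne : ∀ v < n, v ≠ u → f' v = f v) :
    Rep A₀ A₁ n Δ k c f' q (σ.setCell 2 u (f' u).toNat) := by
  refine ⟨h.size, h.deg, h.len, ?_, ?_, ?_, ?_, h.tossed⟩
  · simp [h.start]
  · simp [h.adj]
  · intro v hv
    by_cases hvu : v = u
    · subst hvu
      simp
    · simp [hvu, h.bits v hv, hne v hv hvu]
  · simpa using h.queue

/-- The i-th listed neighbour receives sample `s.used + i`. As the list has no repetitions, this is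
the numbering by `idxOf` in `Config.resample`. -/
theorem halts_resampleNbrs (hL : Layout n Δ nbr A₀ A₁) (hF : Fits w k n) (ha : a < 2 ^ k)
    {s : Config} (h : Holds A₀ A₁ n Δ k a ω s σ) {v : ℕ} (hv : v < n) (h7 : σ.reg 7 = v)
    (h8 : σ.reg 8 = A₀ (v + 1)) (hlen : s.queue.length ≤ 2 * n) :
    Halts w ω (resampleNbrs k a) (fun t σ' =>
      t ≤ (7 * k + 60) * (nbr v).length + 16 * ((nbr v).flatMap nbr).length + 10 ∧
      Holds A₀ A₁ n Δ k a ω (s.resample nbr v) σ' ∧ σ'.reg 6 = σ.reg 6) σ := by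
  have hsq := hF.sq
  have hpow : 2 ^ k < 2 ^ w := by nlinarith [hF.pow, Nat.one_le_two_pow (n := k), hL.pos]
  have hend := hL.start_succ v hv
  have hend' := hL.start_le (v + 1) hv
  have hnd := hL.isNbr.nodup v hv
  have hflat : s.queue.length + ((nbr v).flatMap nbr).length ≤ 2 * n + n * n :=
    add_le_add hlen ((length_flatMap_le hL.isNbr hv).trans (Nat.mul_le_mul hL.le hL.le))
  refine halts_seq (halts_assign (A₀ v) (by simp [Rep.start h, h7]) ?_)
  -- After i rounds only the first i neighbours hold new samples. The potential charges each round
  -- for its draw, and 16 for each appended queue entry.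
  refine halts_for (fun i σ' => Rep A₀ A₁ n Δ k (s.used + i) (fun u => sampleBit k (a + 1)
      (if u ∈ (nbr v).take i then s.used + (nbr v).idxOf u else s.slot u) ω)
      (s.queue ++ ((nbr v).take i).flatMap nbr) σ' ∧ σ'.reg 8 = A₀ (v + 1) ∧
      σ'.reg 9 = A₀ v + i ∧ σ'.reg 6 = σ.reg 6)
    (fun i => (7 * k + 60) * i + 16 * (((nbr v).take i).flatMap nbr).length) (nbr v).length
    ⟨?_, ?_, ?_, ?_⟩ ?_ ?_ ?_
  · simpa using Rep.setReg h (by decide) (by decide) (by decide)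
  · simp [h8]
  · simp
  · simp
  · rintro i hi σ' ⟨hr, h8, h9, -⟩
    rw [eval_lt (by omega)]
    simp [h8, h9, hend]
  · rintro i hi σ' ⟨hr, h8, h9, h6⟩
    have htake : (nbr v).take (i + 1) = (nbr v).take i ++ [(nbr v)[i]] := by simp
    have hun : (nbr v)[i] < n := hL.isNbr.lt v hv _ (List.getElem_mem hi)
    set u := (nbr v)[i] with hu
    have hflat_succ : ((nbr v).take (i + 1)).flatMap nbr =
        ((nbr v).take i).flatMap nbr ++ nbr u := by
      rw [htake]
      simp
    have hflat_le : (((nbr v).take (i + 1)).flatMap nbr).length ≤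
        ((nbr v).flatMap nbr).length := by
      conv_rhs => rw [← List.take_append_drop (i + 1) (nbr v), List.flatMap_append]
      rw [List.length_append]
      omega
    refine halts_seq (halts_assign u (by simp [hr.adj, h9, hu, hL.getElem v hv i hi]) ?_)
    have hr1 := hr.setReg (x := 11) (y := u) (by decide) (by decide) (by decide)
    refine halts_seq ((hr1.halts_draw hpow ha).mono ?_)
    rintro t₂ σ₂ ⟨ht₂, hr₂, hbit, hreg₂⟩
    have h11 : σ₂.reg 11 = u := by simp [hreg₂]
    set g : ℕ → Bool := fun y => sampleBit k (a + 1)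
      (if y ∈ (nbr v).take (i + 1) then s.used + (nbr v).idxOf y else s.slot y) ω with hg
    have hgu : g u = sampleBit k (a + 1) (s.used + i) ω := by
      have h1 : u ∈ (nbr v).take (i + 1) := by simp [htake]
      have h2 : (nbr v).idxOf u = i := hnd.idxOf_getElem i hi
      simp only [hg, h1, h2, if_true]
    have hr₃ := hr₂.setBit (f' := g) (u := u) (by
      intro y _ hy
      simp only [hg, htake, List.mem_append, List.mem_singleton, hy, or_false])
    refine halts_seq (halts_store u (g u).toNat (by simp [h11]) (by rw [hbit, hgu]) ?_)
    refine halts_seq ((halts_appendNbrs hL hF hr₃ hun (by simp [h11]) ?_).mono ?_)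
    · rw [hflat_succ, List.length_append] at hflat_le
      rw [List.length_append]
      omega
    rintro t₄ σ₄ ⟨ht₄, hr₄, hreg₄⟩
    have h9' : σ₄.reg 9 = A₀ v + i := by
      rw [hreg₄ 9 (by decide) (by decide) (by decide), State.setCell_reg,
        hreg₂ 9 (by decide) (by decide)]
      simp [h9]
    refine halts_inc (by omega) ⟨⟨?_, ?_, ?_, ?_⟩, ?_⟩
    · rw [hflat_succ, ← List.append_assoc]
      exact hr₄.setReg (by decide) (by decide) (by decide)
    · simp [hreg₄, hreg₂, h8]
    · simp [h9', add_assoc]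
    · simp [hreg₄, hreg₂, h6]
    · rw [hflat_succ, List.length_append]
      simp only [Expr.cost]
      rw [mul_add, mul_add]
      omega
  · rintro T σ' ⟨hr, -, -, h6⟩ hT
    rw [List.take_length] at hr
    refine ⟨?_, hr, h6⟩
    simp only [Expr.cost, List.take_length] at hT ⊢
    simp only [List.take_zero, List.flatMap_nil, List.length_nil, mul_zero, Nat.zero_add] at hT
    omega

/-- The bound on the running time of the main loop when it has reached time `t` with a queue of
length `l`. -/
def processBound (k Δ t l : ℕ) : ℕ := ((7 * k + 80) * Δ + 100) * t + 16 * l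

/-- The guard gives t < queue length ≤ 2n, so there are at most 2n iterations. The bound 2n + Δ²
allows for the one resampling that may push the queue over the limit before the guard stops the
loop. -/
theorem halts_processQueue (hL : Layout n Δ nbr A₀ A₁) (hF : Fits w k n) (ha : a < 2 ^ k)
    (h : Holds A₀ A₁ n Δ k a ω (.start n) σ) (h6 : σ.reg 6 = 0) :
    Halts w ω (processQueue k a) (fun T σ' =>
      T ≤ processBound k Δ (2 * n) (2 * n + Δ * Δ) + 20 ∧
      ∃ t ≤ 2 * n, Holds A₀ A₁ n Δ k a ω
          (run nbr n (viol k a Δ) (fun m => sampleBit k (a + 1) m ω) t) σ' ∧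
        ((run nbr n (viol k a Δ) (fun m => sampleBit k (a + 1) m ω) t).queue.length ≤ 2 * n →
          (run nbr n (viol k a Δ) (fun m => sampleBit k (a + 1) m ω) t).queue.length ≤ t)) σ := by
  have hsq := hF.sq
  set r := run nbr n (viol k a Δ) (fun m => sampleBit k (a + 1) m ω) with hrdef
  have hguard : ∀ t σ', Holds A₀ A₁ n Δ k a ω (r t) σ' → σ'.reg 6 = t →
      -- The product of two comparison bits acts as a conjunction.
      ((op mul (op lt (reg 6) (reg 5)) (op lt (reg 5)
        (op add (op mul (const 2) (reg 0)) (const 1)))).eval w σ' ≠ 0 ↔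
      t < (r t).queue.length ∧ (r t).queue.length ≤ 2 * n) := by
    intro t σ' hr h6
    have e1 : (op mul (const 2) (reg 0)).eval w σ' = 2 * n := by
      rw [eval_mul] <;> rw [eval_const (by omega), eval_reg, Rep.size hr]
      omega
    have e2 : (op add (op mul (const 2) (reg 0)) (const 1)).eval w σ' = 2 * n + 1 := by
      rw [eval_add] <;> rw [eval_const (by omega), e1]
      omega
    have e3 := eval_lt (w := w) (σ := σ') (e₁ := reg 6) (e₂ := reg 5) (by omega)
    have e4 := eval_lt (w := w) (σ := σ') (e₁ := reg 5)
      (e₂ := op add (op mul (const 2) (reg 0)) (const 1)) (by omega)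
    rw [eval_reg, eval_reg, h6, Rep.len hr] at e3
    rw [e2, eval_reg, Rep.len hr] at e4
    rw [eval_mul] <;> rw [e3, e4]
    · split_ifs with h1 h2 h2 <;> simp <;> omega
    · split_ifs <;> omega
  refine halts_loop (fun t σ' => Holds A₀ A₁ n Δ k a ω (r t) σ' ∧ σ'.reg 6 = t ∧ t ≤ 2 * n ∧
      (r t).queue.length ≤ 2 * n + Δ * Δ)
    (fun t => processBound k Δ t (r t).queue.length) (2 * n) ⟨h, h6, Nat.zero_le _, ?_⟩ ?_ ?_ ?_
  · simp [hrdef, run, Config.start]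
    omega
  · rintro t σ' ⟨hr, h6, -, -⟩ he
    have := (hguard t σ' hr h6).1 he
    omega
  · rintro t σ' ⟨hr, h6, -, -⟩ he
    obtain ⟨htl, hl⟩ := (hguard t σ' hr h6).1 he
    set v := (r t).vertex t with hv
    have hvn : v < n := (valid_run hL.isNbr hL.pos _ t).vertex_lt hL.pos t
    have hdeg := hL.isNbr.length_le v hvn
    have hr' : Rep A₀ A₁ n Δ k _ _ _ σ' := hr
    refine halts_seq (halts_assign v ?_ ?_)
    · simp only [eval_cell, eval_reg, h6]
      rw [Rep.queue hr t htl, hv, Config.vertex, List.getD_eq_getElem _ _ htl]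
    refine halts_seq (halts_inc (by simp; omega) ?_)
    have hr₂ := (hr'.setReg (x := 7) (y := v) (by decide) (by decide) (by decide)).setReg
      (x := 6) (y := (σ'.setReg 7 v).reg 6 + 1) (by decide) (by decide) (by decide)
    refine halts_seq ((halts_countSelected hL hF hr₂ hvn (by simp)).mono ?_)
    rintro t₃ σ₃ ⟨ht₃, hr₃, h8, h10, hreg₃⟩
    have h7 : σ₃.reg 7 = v := by simp [hreg₃]
    have h6' : σ₃.reg 6 = t + 1 := by simp [hreg₃, h6]
    have htest := eval_violatedTest (a := a) hL hF hr₃ hvn h7 h8 h10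
    have hdeg' : (7 * k + 60) * (nbr v).length ≤ (7 * k + 60) * Δ := Nat.mul_le_mul le_rfl hdeg
    have hmul : (7 * k + 80) * Δ = (7 * k + 60) * Δ + 20 * Δ := by ring
    refine halts_cond (fun he => ?_) fun he => ?_
    · have hviol := htest.1 he
      have hnext : r (t + 1) = (r t).resample nbr v := by
        simp only [hrdef, run]
        exact if_pos hviol
      refine (halts_resampleNbrs hL hF ha hr₃ hvn h7 h8 hl).mono ?_
      rintro t₄ σ₄ ⟨ht₄, hr₄, h6₄⟩
      have hql : (r (t + 1)).queue.length =
          (r t).queue.length + ((nbr v).flatMap nbr).length := by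
        rw [hnext]
        exact List.length_append
      refine ⟨⟨hnext ▸ hr₄, by rw [h6₄, h6'], by omega, ?_⟩, ?_⟩
      · rw [hql]
        exact add_le_add hl (length_flatMap_le hL.isNbr hvn)
      · rw [hql]
        simp only [processBound, violatedTest, Expr.cost, hmul, mul_add _ t 1, mul_one]
        omega
    · have hviol := fun hcon => htest.2 hcon he
      have hnext : r (t + 1) = r t := by
        simp only [hrdef, run]
        exact if_neg hviol
      refine halts_skip ⟨⟨hnext ▸ hr₃, h6', by omega, ?_⟩, ?_⟩
      · rw [hnext]
        omega
      · rw [hnext]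
        simp only [processBound, violatedTest, Expr.cost, hmul, mul_add _ t 1, mul_one]
        omega
  · rintro t T σ' ⟨hr, h6, ht, hl⟩ he hT
    refine ⟨?_, t, ht, hr, ?_⟩
    · have h1 : ((7 * k + 80) * Δ + 100) * t ≤ ((7 * k + 80) * Δ + 100) * (2 * n) :=
        Nat.mul_le_mul le_rfl ht
      simp only [processBound, Expr.cost] at hT ⊢
      omega
    · intro hl'
      by_contra hcon
      exact (hguard t σ' hr h6).2 ⟨by omega, hl'⟩ he

theorem halts_scanDegrees (hL : Layout n Δ nbr A₀ A₁) (hF : Fits w k n)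
    (hΔ : (Finset.range n).sup (fun v => (nbr v).length) = Δ) (h0 : σ.reg 0 = n)
    (h1 : σ.reg 1 = 0) (hA₀ : σ.arr 0 = A₀) :
    Halts w ω scanDegrees (fun t σ' => t ≤ 30 * n + 10 ∧ σ'.reg 0 = n ∧ σ'.reg 1 = Δ ∧
      σ'.arr = σ.arr ∧ σ'.tossed = σ.tossed) σ := by
  have hsq := hF.sq
  refine halts_seq (halts_assign 0 (eval_const (by omega)) ?_)
  refine halts_for (fun i σ' => σ'.reg 0 = n ∧
      σ'.reg 1 = (Finset.range i).sup (fun v => (nbr v).length) ∧ σ'.reg 2 = i ∧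
      σ'.arr = σ.arr ∧ σ'.tossed = σ.tossed) (fun i => 30 * i) n ?_ ?_ ?_ ?_
  · simp [h0, h1]
  · rintro i hi σ' ⟨hr, -, h2, -⟩
    rw [eval_lt (by omega)]
    simp [hr, h2]
  · rintro i hi σ' ⟨hr0, hr1, hr2, harr, htoss⟩
    have hnl := hL.length_le hi
    have hsub : (op sub (cell 0 (op add (reg 2) (const 1))) (cell 0 (reg 2))).eval w σ' =
        (nbr i).length := by
      have e1 : (op add (reg 2) (const 1)).eval w σ' = i + 1 := by
        rw [eval_add] <;> rw [eval_const (by omega), eval_reg, hr2]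
        omega
      have e2 : (cell 0 (op add (reg 2) (const 1))).eval w σ' - (cell 0 (reg 2)).eval w σ' =
          (nbr i).length := by
        simp [e1, hr2, harr, hA₀, hL.start_succ i hi]
      rw [eval_sub] <;> rw [e2]
      omega
    refine halts_seq (halts_assign _ hsub ?_)
    have hlt := eval_lt (w := w) (σ := σ'.setReg 3 (nbr i).length) (e₁ := reg 1) (e₂ := reg 3)
      (by omega)
    refine halts_seq (halts_cond (fun he => ?_) fun he => ?_)
    · rw [hlt] at he
      refine halts_assign (nbr i).length (by simp) (halts_inc (by simp; omega) ?_)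
      have : σ'.reg 1 ≤ (nbr i).length := by
        by_contra hcon
        simp at he
        omega
      simp [hr0, hr2, harr, htoss, Finset.range_add_one, ← hr1, this, Expr.cost]
      omega
    · rw [hlt] at he
      refine halts_skip (halts_inc (by simp; omega) ?_)
      have : (nbr i).length ≤ σ'.reg 1 := by
        by_contra hcon
        simp at he
        omega
      simp [hr0, hr2, harr, htoss, Finset.range_add_one, ← hr1, this, Expr.cost]
      omega
  · rintro T σ' ⟨hr0, hr1, -, harr, htoss⟩ hT
    refine ⟨?_, hr0, hr1.trans hΔ, harr, htoss⟩
    simp only [Expr.cost] at hT ⊢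
    omega

theorem halts_sampleAll (hF : Fits w k n) (hn : 0 < n) (ha : a < 2 ^ k) (h0 : σ.reg 0 = n)
    (h1 : σ.reg 1 = Δ) (hA₀ : σ.arr 0 = A₀) (hA₁ : σ.arr 1 = A₁) (htoss : σ.tossed = 0) :
    Halts w ω (sampleAll k a) (fun t σ' => t ≤ (7 * k + 30) * n + 20 ∧
      Holds A₀ A₁ n Δ k a ω (.start n) σ' ∧ σ'.reg 6 = 0) σ := by
  have hsq := hF.sq
  have hpow : 2 ^ k < 2 ^ w := by nlinarith [hF.pow, Nat.one_le_two_pow (n := k), hn]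
  refine halts_seq (halts_assign 0 (eval_const (by omega)) (halts_seq ?_))
  refine halts_for (fun i σ' => σ'.reg 0 = n ∧ σ'.reg 1 = Δ ∧ σ'.reg 2 = i ∧ σ'.arr 0 = A₀ ∧
      σ'.arr 1 = A₁ ∧ (∀ v < i, σ'.arr 2 v = (sampleBit k (a + 1) v ω).toNat) ∧
      (∀ v < i, σ'.arr 3 v = v) ∧ σ'.tossed = k * i) (fun i => (7 * k + 30) * i) n ?_ ?_ ?_ ?_
  · simp [h0, h1, hA₀, hA₁, htoss]
  · rintro i hi σ' ⟨hr, -, h2, -⟩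
    rw [eval_lt (by omega)]
    simp [hr, h2]
  · rintro i hi σ' ⟨hr0, hr1, hr2, ha0, ha1, hbits, hqueue, ht⟩
    refine halts_seq ((halts_draw hpow).mono ?_)
    rintro t₁ σ₁ ⟨ht₁, h3, harr, htoss₁, hreg⟩
    have hr2' : σ₁.reg 2 = i := by rw [hreg 2 (by decide) (by decide), hr2]
    have hbit : (op lt (reg 3) (const (a + 1))).eval w σ₁ = (sampleBit k (a + 1) i ω).toNat := by
      rw [eval_lt (by omega), eval_const (by omega), eval_reg, h3, ht]
      simp only [sampleBit, sampleValue]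
      split_ifs with hlt <;> simp [hlt]
    refine halts_seq (halts_store i _ (by simp [hr2']) hbit ?_)
    refine halts_seq (halts_store i i (by simp [hr2']) (by simp [hr2']) ?_)
    refine halts_inc (by simp [hr2']; omega) ⟨⟨?_, ?_, ?_, ?_, ?_, ?_, ?_, ?_⟩, ?_⟩
    · simp [hreg, hr0]
    · simp [hreg, hr1]
    · simp [hr2']
    · simp [harr, ha0]
    · simp [harr, ha1]
    · intro v hv
      by_cases hvi : v = i
      · simp [hvi]
      · simp [hvi, harr, hbits v (by omega)]
    · intro v hv
      by_cases hvi : v = i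
      · simp [hvi]
      · simp [hvi, harr, hqueue v (by omega)]
    · simp [htoss₁, ht, mul_add]
    · simp only [Expr.cost, mul_add _ i 1]
      omega
  · rintro T σ' ⟨hr0, hr1, hr2, ha0, ha1, hbits, hqueue, ht⟩ hT
    refine halts_seq (halts_assign n (by simp [hr0]) (halts_assign 0 (eval_const (by omega)) ?_))
    refine ⟨?_, ⟨?_, ?_, ?_, ?_, ?_, ?_, ?_, ?_⟩, ?_⟩
    · simp only [Expr.cost] at hT ⊢
      omega
    · simp [hr0]
    · simp [hr1]
    · simp [Config.start]
    · simp [ha0]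
    · simp [ha1]
    · simpa [Config.start] using hbits
    · intro i hi
      have hi' : i < n := by simpa [Config.start] using hi
      simp [Config.start, hqueue i hi']
    · simp [ht, Config.start]
    · simp

/-- The program halts in time `O(n Δ)`, and if the run succeeds, then no vertex is violated. -/
theorem halts_seedingProg (hL : Layout n Δ nbr A₀ A₁) (hF : Fits w k n) (ha : a < 2 ^ k)
    (hΔ : (Finset.range n).sup (fun v => (nbr v).length) = Δ) (hpos : 0 < Δ) (h0 : σ.reg 0 = n)
    (h1 : σ.reg 1 = 0) (hA₀ : σ.arr 0 = A₀) (hA₁ : σ.arr 1 = A₁) (htoss : σ.tossed = 0) :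
    Halts w ω (seedingProg k a) (fun T σ' => T ≤ (21 * k + 600) * (n * Δ) ∧
      (Succeeds nbr n (viol k a Δ) (fun m => sampleBit k (a + 1) m ω) →
        ∃ f : ℕ → Bool, (∀ v < n, σ'.arr 2 v = (f v).toNat) ∧
          ∀ v < n, viol k a Δ ((nbr v).countP f) (nbr v).length = false)) σ := by
  refine halts_seq ((halts_scanDegrees hL hF hΔ h0 h1 hA₀).mono ?_)
  rintro t₁ σ₁ ⟨ht₁, h0₁, h1₁, harr₁, htoss₁⟩
  refine halts_seq ((halts_sampleAll hF hL.pos ha h0₁ h1₁ (by rw [harr₁, hA₀])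
    (by rw [harr₁, hA₁]) (by rw [htoss₁, htoss])).mono ?_)
  rintro t₂ σ₂ ⟨ht₂, hr₂, h6₂⟩
  refine (halts_processQueue hL hF ha hr₂ h6₂).mono ?_
  rintro t₃ σ₃ ⟨ht₃, t, ht, hr, hlen⟩
  constructor
  · have hn := hL.pos
    have hle := hL.le
    simp only [processBound] at ht₃
    have e1 : n ≤ n * Δ := Nat.le_mul_of_pos_right n hpos
    have e2 : Δ * Δ ≤ n * Δ := Nat.mul_le_mul hle le_rfl
    have e3 : k * n ≤ k * (n * Δ) := Nat.mul_le_mul le_rfl e1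
    have e4 : 1 ≤ n * Δ := Nat.mul_pos hn hpos
    calc t₁ + (t₂ + t₃) ≤ (30 * n + 10) + (((7 * k + 30) * n + 20) +
          (((7 * k + 80) * Δ + 100) * (2 * n) + 16 * (2 * n + Δ * Δ) + 20)) := by omega
      _ = 14 * (k * (n * Δ)) + 7 * (k * n) + 160 * (n * Δ) + 292 * n + 16 * (Δ * Δ) + 50 := by ring
      _ ≤ 14 * (k * (n * Δ)) + 7 * (k * (n * Δ)) + 160 * (n * Δ) + 292 * (n * Δ) +
          16 * (n * Δ) + 50 * (n * Δ) := by omega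
      _ = (21 * k + 518) * (n * Δ) := by ring
      _ ≤ (21 * k + 600) * (n * Δ) := Nat.mul_le_mul (by omega) le_rfl
  · intro hs
    -- On success the cutoff never acts, so the loop stopped because the queue was exhausted; a
    -- violated vertex would have to be in its empty remainder.
    refine ⟨_, Rep.bits hr, fun v hv => ?_⟩
    by_contra hcon
    have hviol := mem_drop_of_violated (viol := viol k a Δ) (by simp [viol]) hL.isNbr hL.pos
      (fun m => sampleBit k (a + 1) m ω) t hv (by simpa [violated] using hcon)
    rw [List.drop_eq_nil_of_le (hlen (hs t ht))] at hviol
    simp at hviol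

end WordRAM

/-! ### From adjacency lists to graphs, and existence of the set -/

namespace LocalResampling

/-- The lists `nbr` represent the graph `G`, whose vertices `ι` numbers from `0` to `n - 1`. -/
structure Encodes {V : Type*} (G : SimpleGraph V) (n : ℕ) (ι : V → ℕ) (nbr : ℕ → List ℕ) :
    Prop where
  inj : Function.Injective ι
  lt : ∀ v, ι v < n
  surj : ∀ i < n, ∃ v, ι v = i
  nodup : ∀ v, (nbr (ι v)).Nodup
  mem : ∀ v i, i ∈ nbr (ι v) ↔ ∃ u, G.Adj v u ∧ ι u = i

variable {V : Type*} {G : SimpleGraph V} {n : ℕ} {ι : V → ℕ} {nbr : ℕ → List ℕ}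

/-- Stated for an arbitrary predicate, so that it also counts the unselected neighbours and, for the
constant `true`, the degree. -/
theorem Encodes.ncard_inter (h : Encodes G n ι nbr) (v : V) (f : ℕ → Bool) :
    (G.neighborSet v ∩ {u | f (ι u)}).ncard = (nbr (ι v)).countP f := by
  rw [← Set.ncard_image_of_injective _ h.inj, List.countP_eq_length_filter,
    ← List.toFinset_card_of_nodup ((h.nodup v).filter f), ← Set.ncard_coe_finset]
  congr 1
  ext i
  simp only [Set.mem_image, Set.mem_inter_iff, SimpleGraph.mem_neighborSet, Set.mem_ofPred_eq,
    List.coe_toFinset, List.mem_filter, h.mem]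
  constructor
  · rintro ⟨u, ⟨hu, hf⟩, rfl⟩
    exact ⟨⟨u, hu, rfl⟩, hf⟩
  · rintro ⟨⟨u, hu, rfl⟩, hf⟩
    exact ⟨u, ⟨hu, hf⟩, rfl⟩

theorem Encodes.length_eq_degree [Fintype V] [DecidableRel G.Adj] (h : Encodes G n ι nbr) (v : V) :
    (nbr (ι v)).length = G.degree v := by
  have := h.ncard_inter v fun _ => true
  simp only [Set.ofPred_true, Set.inter_univ] at this
  rw [← SimpleGraph.card_neighborSet_eq_degree, ← Nat.card_eq_fintype_card,
    Nat.card_coe_set_eq, this]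
  simp

theorem Encodes.isNbr [Fintype V] [DecidableRel G.Adj] (h : Encodes G n ι nbr) :
    IsNbr n G.maxDegree nbr where
  nodup i hi := by
    obtain ⟨v, rfl⟩ := h.surj i hi
    exact h.nodup v
  length_le i hi := by
    obtain ⟨v, rfl⟩ := h.surj i hi
    rw [h.length_eq_degree]
    exact G.degree_le_maxDegree v
  lt i hi j hj := by
    obtain ⟨v, rfl⟩ := h.surj i hi
    obtain ⟨u, -, rfl⟩ := (h.mem v j).1 hj
    exact h.lt u
  symm i hi j hj := by
    obtain ⟨v, rfl⟩ := h.surj i hi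
    obtain ⟨u, hu, rfl⟩ := (h.mem v j).1 hj
    exact (h.mem u _).2 ⟨v, hu.symm, rfl⟩

theorem Encodes.sup_length [Fintype V] [Nonempty V] [DecidableRel G.Adj]
    (h : Encodes G n ι nbr) :
    (Finset.range n).sup (fun i => (nbr i).length) = G.maxDegree := by
  refine le_antisymm (Finset.sup_le fun i hi => h.isNbr.length_le i (Finset.mem_range.1 hi)) ?_
  obtain ⟨v, hv⟩ := G.exists_maximal_degree_vertex
  rw [hv, ← h.length_eq_degree]
  exact Finset.le_sup (f := fun i => (nbr i).length) (Finset.mem_range.2 (h.lt v))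

theorem Encodes.isSeedingSet (h : Encodes G n ι nbr) {η : ℝ} {k a Δ : ℕ}
    (ha : a ≤ 2 ^ k) (hη : η ≤ a / 2 ^ k) (f : ℕ → Bool)
    (hf : ∀ i < n, viol k a Δ ((nbr i).countP f) (nbr i).length = false) :
    IsSeedingSet G η Δ {v | f (ι v)} := by
  intro v
  have hv := hf (ι v) (h.lt v)
  simp only [viol, decide_eq_false_iff_not, not_or, not_lt] at hv
  obtain ⟨h1, h2⟩ := hv
  have hcompl : ({v | f (ι v)}ᶜ : Set V) = {v | (fun i => !f i) (ι v)} := by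
    ext u
    simp
  have hlen : (nbr (ι v)).length - (nbr (ι v)).countP f = (nbr (ι v)).countP fun i => !f i := by
    have := List.length_eq_countP_add_countP f (l := nbr (ι v))
    simp only [Bool.not_eq_true, Bool.decide_eq_false] at this
    omega
  rw [hcompl, h.ncard_inter v fun i => !f i, h.ncard_inter v f]
  rw [hlen] at h2
  constructor
  · have h2' : (2 : ℝ) ^ k * ((nbr (ι v)).countP fun i => !f i) ≤ (2 ^ k - a) * Δ := by
      have : ((2 ^ k * ((nbr (ι v)).countP fun i => !f i) : ℕ) : ℝ) ≤
        ((2 ^ k - a : ℕ) * Δ : ℕ) := by exact_mod_cast h2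
      push_cast [Nat.cast_sub ha] at this
      exact this
    have hpow : (0 : ℝ) < 2 ^ k := by positivity
    rw [le_div_iff₀ hpow] at hη
    refine le_of_mul_le_mul_left (h2'.trans ?_) hpow
    calc ((2 : ℝ) ^ k - a) * Δ ≤ (2 ^ k - η * 2 ^ k) * Δ := by gcongr
      _ = 2 ^ k * ((1 - η) * Δ) := by ring
  · rw [le_div_iff₀ (by norm_num)]
    have : ((3 * (nbr (ι v)).countP f : ℕ) : ℝ) ≤ Δ := by exact_mod_cast h1
    push_cast at this
    linarith

theorem nonempty_of_maxDegree_pos [Fintype V] [DecidableRel G.Adj] (h : 0 < G.maxDegree) :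
    Nonempty V := by
  by_contra hcon
  have := not_nonempty_iff.1 hcon
  have hle := G.maxDegree_le_of_forall_degree_le 0 fun v => isEmptyElim v
  omega

theorem exists_encodes [Fintype V] (G : SimpleGraph V) [DecidableRel G.Adj] :
    ∃ (ι : V → ℕ) (nbr : ℕ → List ℕ), Encodes G (Fintype.card V) ι nbr := by
  classical
  set e := Fintype.equivFin V
  refine ⟨fun v => e v, fun i => if h : i < Fintype.card V then
    (G.neighborFinset (e.symm ⟨i, h⟩)).toList.map fun u => (e u : ℕ) else [], ?_, ?_, ?_, ?_, ?_⟩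
  · exact fun u v h => e.injective (Fin.ext h)
  · exact fun v => (e v).2
  · exact fun i hi => ⟨e.symm ⟨i, hi⟩, by simp⟩
  · intro v
    simp only [Fin.is_lt, dif_pos, Fin.eta]
    exact (Finset.nodup_toList _).map fun u v h => e.injective (Fin.ext h)
  · intro v i
    simp

/-- An event of probability at least 1/2 is nonempty. For any outcome in it the queue is exhausted
at time 2n, and the samples then held define the set. -/
theorem exists_isSeedingSet [Fintype V] (G : SimpleGraph V) [DecidableRel G.Adj] {η : ℝ} {k a : ℕ}
    (ha : 3 * (a + 2) ≤ 2 ^ k) (hη : η ≤ a / 2 ^ k) (hpos : 0 < G.maxDegree)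
    (hC : 12 * (G.maxDegree : ℝ) ^ 2 * (2 * Real.exp (-2 * G.maxDegree * (1 / 2 ^ k) ^ 2)) ≤ 1) :
    ∃ S : Set V, IsSeedingSet G η G.maxDegree S := by
  obtain ⟨ι, nbr, h⟩ := exists_encodes G
  have := nonempty_of_maxDegree_pos hpos
  have hn : 0 < Fintype.card V := Fintype.card_pos
  have hhalf := half_le_coinLaw_succeeds h.isNbr hn hpos ha hC
  obtain ⟨ω, hω⟩ := MeasureTheory.nonempty_of_measure_ne_zero
    (ne_of_gt (lt_of_lt_of_le (by norm_num) hhalf))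
  refine ⟨_, h.isSeedingSet (by omega) hη (fun i => sampleBit k (a + 1) ((run nbr (Fintype.card V)
    (viol k a G.maxDegree) (fun m => sampleBit k (a + 1) m ω) (2 * Fintype.card V)).slot i) ω) ?_⟩
  intro i hi
  by_contra hcon
  have hviol := mem_drop_of_violated (viol := viol k a G.maxDegree) (by simp [viol]) h.isNbr hn
    (fun m => sampleBit k (a + 1) m ω) (2 * Fintype.card V) hi (by simpa [violated] using hcon)
  rw [List.drop_eq_nil_of_le (hω _ le_rfl)] at hviol
  simp at hviol

end LocalResampling

/-! ### The input format and the word length -/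

namespace WordRAM

open LocalResampling

/-- The adjacency list of `v` that is stored in the arrays `A₀` and `A₁`. -/
def storedList (A₀ A₁ : ℕ → ℕ) (v : ℕ) : List ℕ :=
  (List.range (A₀ (v + 1) - A₀ v)).map fun i => A₁ (A₀ v + i)

variable {n : ℕ} {G : SimpleGraph (Fin n)} [DecidableRel G.Adj] {σ : State}

theorem HoldsGraph.encodes (h : HoldsGraph G σ) :
    Encodes G n (fun v : Fin n => (v : ℕ)) (storedList (σ.arr 0) (σ.arr 1)) where
  inj := Fin.val_injective
  lt v := v.2
  surj i hi := ⟨⟨i, hi⟩, rfl⟩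
  nodup v := by
    refine List.Nodup.map_on ?_ List.nodup_range
    intro i hi j hj hij
    rw [List.mem_range] at hi hj
    have := (h.adjacency v).injOn ⟨by omega, by omega⟩ ⟨by omega, by omega⟩ hij
    omega
  mem v i := by
    have himage := (h.adjacency v).image_eq
    have hmem : i ∈ storedList (σ.arr 0) (σ.arr 1) v ↔
        i ∈ σ.arr 1 '' Set.Ico (σ.arr 0 v) (σ.arr 0 (v + 1)) := by
      simp only [storedList, List.mem_map, List.mem_range, Set.mem_image, Set.mem_Ico]
      constructor
      · rintro ⟨j, hj, rfl⟩
        exact ⟨_, ⟨by omega, by omega⟩, rfl⟩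
      · rintro ⟨j, ⟨hj, hj'⟩, rfl⟩
        exact ⟨j - σ.arr 0 v, by omega, by rw [Nat.add_sub_cancel' hj]⟩
    rw [hmem, himage]
    simp [SimpleGraph.mem_neighborSet]

theorem HoldsGraph.layout (h : HoldsGraph G σ) (hpos : 0 < G.maxDegree) :
    Layout n G.maxDegree (storedList (σ.arr 0) (σ.arr 1)) (σ.arr 0) (σ.arr 1) where
  isNbr := h.encodes.isNbr
  pos := by
    obtain ⟨v⟩ := nonempty_of_maxDegree_pos hpos
    exact v.pos
  le := by
    refine G.maxDegree_le_of_forall_degree_le n fun v => ?_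
    simpa using (G.degree_lt_card_verts v).le
  start_succ v hv := by
    have := h.start_succ ⟨v, hv⟩
    simp only at this
    simp [storedList, this]
  start_le v hv := by
    -- The start of a list is the sum of the earlier degrees, each less than n.
    have key : ∀ v ≤ n, σ.arr 0 v ≤ v * n := by
      intro v
      induction v with
      | zero => simp [h.start_zero]
      | succ v ih =>
        intro hv
        have h1 := h.start_succ ⟨v, hv⟩
        have h2 := G.degree_lt_card_verts ⟨v, hv⟩
        have h3 := ih (by omega)
        simp only [Fintype.card_fin] at h1 h2
        rw [h1, Nat.succ_mul]
        omega
    exact (key v hv).trans (Nat.mul_le_mul hv le_rfl)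
  getElem v hv i hi := by simp [storedList]

/-- With L = ⌊log₂ n⌋ + 1, k + L bits leave room for the products in the violation test, and 2L + 2
bits for adjacency and queue positions of order n²; (k + 4) L bits cover both. -/
theorem fits_of_le {w k n : ℕ} (h : (k + 4) * (Nat.log 2 n + 1) ≤ w) : Fits w k n := by
  set L := Nat.log 2 n + 1 with hL
  have hL1 : 1 ≤ L := by omega
  have hn : n < 2 ^ L := Nat.lt_pow_succ_log_self one_lt_two n
  have hkL : k ≤ k * L := Nat.le_mul_of_pos_right k hL1
  rw [add_mul] at h
  constructor
  · calc 2 ^ k * (n + 1) ≤ 2 ^ k * 2 ^ L := Nat.mul_le_mul le_rfl hn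
      _ = 2 ^ (k + L) := (pow_add ..).symm
      _ < 2 ^ w := Nat.pow_lt_pow_right one_lt_two (by omega)
  · calc n * n + 4 * n + 4 = (n + 2) * (n + 2) := by ring
      _ < 2 ^ (L + 1) * 2 ^ (L + 1) := by
          have : n + 2 < 2 ^ (L + 1) := by
            have : 2 ≤ 2 ^ L := by simpa using Nat.pow_le_pow_right (n := 2) (by norm_num) hL1
            rw [pow_succ]
            omega
          exact Nat.mul_lt_mul'' this this
      _ = 2 ^ (L + 1 + (L + 1)) := (pow_add ..).symm
      _ ≤ 2 ^ w := Nat.pow_le_pow_right (by norm_num) (by omega)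

end WordRAM

/-! ### The theorem -/

open LocalResampling WordRAM in
theorem proposition3p1 (η : ℝ) (hη₀ : 0 < η) (hη₁ : η < 1 / 3) :
    ∃ C : ℕ,
      (∀ (V : Type*) [Fintype V] (G : SimpleGraph V) [DecidableRel G.Adj] (Δ : ℕ),
        G.maxDegree = Δ → C ≤ Δ → ∃ S : Set V, IsSeedingSet G η Δ S) ∧
      ∃ (P : WordRAM.Prog) (b : ℕ) (K : ℝ),
        ∀ (n : ℕ) (G : SimpleGraph (Fin n)) [DecidableRel G.Adj] (Δ : ℕ),
          G.maxDegree = Δ → C ≤ Δ →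
          ∀ (w : ℕ), b * (Nat.log 2 n + 1) ≤ w →
          ∀ σ₀ : WordRAM.State, WordRAM.HoldsGraph G σ₀ →
            (∀ ω : ℕ → Bool, ∃ (t : ℕ) (σ : WordRAM.State),
              WordRAM.Exec w ω P σ₀ t σ ∧ (t : ℝ) ≤ K * (n * Δ + n * Real.log n)) ∧
            1 / 2 ≤ WordRAM.coinLaw {ω | ∃ (t : ℕ) (σ : WordRAM.State),
              WordRAM.Exec w ω P σ₀ t σ ∧ IsSeedingSet G η Δ (WordRAM.output n σ)} := by
  obtain ⟨k, a, ha, hη⟩ := exists_parameters hη₀ hη₁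
  obtain ⟨C, hC0, hC⟩ := exists_degree_bound k
  refine ⟨C, ?_, seedingProg k a, k + 4, (21 * k + 600 : ℕ), ?_⟩
  · rintro V _ G _ Δ rfl hΔ
    exact exists_isSeedingSet G ha hη (by omega) (hC _ hΔ)
  · rintro n G _ Δ rfl hΔ w hw σ₀ hσ₀
    have hpos : 0 < G.maxDegree := by omega
    have hne := nonempty_of_maxDegree_pos hpos
    have hL := hσ₀.layout hpos
    have henc := hσ₀.encodes
    have halts := fun ω => halts_seedingProg (ω := ω) hL (fits_of_le hw) (a := a) (by omega)
      henc.sup_length hpos hσ₀.size (hσ₀.reg_eq_zero 1 one_ne_zero) rfl rfl hσ₀.tossed_eq_zero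
    constructor
    · intro ω
      obtain ⟨t, σ, hexec, ht, -⟩ := halts ω
      refine ⟨t, σ, hexec, ?_⟩
      calc (t : ℝ) ≤ ((21 * k + 600) * (n * G.maxDegree) : ℕ) := by exact_mod_cast ht
        _ = (21 * k + 600 : ℕ) * ((n : ℝ) * G.maxDegree) := by push_cast; ring
        -- The bound O(nΔ) alone suffices; n log n is a nonnegative addition.
        _ ≤ _ := by
          gcongr
          exact le_add_of_nonneg_right (mul_nonneg n.cast_nonneg (Real.log_natCast_nonneg n))
    · refine (half_le_coinLaw_succeeds henc.isNbr hL.pos hpos ha (hC _ hΔ)).trans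
        (MeasureTheory.measure_mono fun ω hω => ?_)
      obtain ⟨t, σ, hexec, -, hs⟩ := halts ω
      obtain ⟨f, hbits, hf⟩ := hs hω
      refine ⟨t, σ, hexec, ?_⟩
      have hout : output n σ = {v : Fin n | f v} := by
        ext v
        simp only [output, Set.mem_ofPred_eq, hbits v v.2]
        cases f v <;> simp
      rw [hout]
      exact henc.isSeedingSet (by omega) hη f hf
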